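/- **Setting.** Let $M$ be a smooth manifold (Hausdorff, second countable), let $\Gamma$ be a $\mathrm{Diff}(M)$-invariant set of smooth tensor fields on $M$ of some fixed type $(r,s)$ (or of tuples of tensor fields of fixed types), and let $q$ assign to each $\gamma\in\Gamma$ a smooth tensor field (or tuple) $q(\gamma)$ of the same type, with $q(f^*\gamma)=f^*q(\gamma)$ for all $f\in\mathrm{Diff}(M)$. Let $\gamma\in\Gamma$ be such that $(M,\gamma)$ is homogeneous, i.e. $\mathrm{Aut}(M,\gamma)=\{f\in\mathrm{Diff}(M): f^*\gamma=\gamma\}$ acts transitively on $M$, and assume that $G:=\mathrm{Aut}(M,\gamma)$ is a (second countable) Lie group acting smoothly on $M$. Fix an origin $o\in M$, let $K\subset G$ be its isotropy subgroup, so that $M=G/K$, and let $\mathfrak g$, $\mathfrak k$ be the Lie algebras of $G$, $K$, so that $T_oM=\mathfrak g/\mathfrak k$. Evaluation at $o$ identifies the set $\Gamma^G$ of $G$-invariant elements of $\Gamma$ with a subset of the finite-dimensional vector space of ($K$-invariant) tensors on $T_oM$; assume that this subset is an embedded smooth submanifold and that $q$ is a smooth tangent vector field on it (so that the flow $\frac{\partial}{\partial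 t}\gamma(t)=q(\gamma(t))$ restricted to $G$-invariant structures is a smooth ODE). **Theorem.** Suppose that $\gamma$ is a soliton, i.e. $q(\gamma)=c\gamma+\mathcal L_X\gamma$ for some $c\in\mathbb R$ and some smooth vector field $X$ on $M$. Let $J$ be an open interval containing $0$ and let $\gamma(t)\in\Gamma$, $t\in J$, be the $\mathrm{Aut}(M,\gamma)$-invariant solution of $\frac{\partial}{\partial t}\gamma(t)=q(\gamma(t))$, $\gamma(0)=\gamma$. If this solution is self-similar, i.e. for every $t\in J$ one has $\gamma(t)=c(t)f(t)^*\gamma$ for some $c(t)\in\mathbb R^*$ and $f(t)\in\mathrm{Diff}(M)$, then $(G/K,\gamma)$ with $G=\mathrm{Aut}(M,\gamma)$ is a semi-algebraic soliton, that is: 1. there are $c\in\mathbb R$ and a derivation $D$ of $\mathfrak g$ with $D\mathfrak k\subset\mathfrak k$ such that, at $o$, $q(\gamma)=c\gamma+\theta(D_{\mathfrak p})\gamma$, where $D_{\mathfrak p}$ is the operator induced by $D$ on $\mathfrak g/\mathfrak k=T_oM$ and $\theta$ is the natural representation of $\mathfrak{gl}(T_oM)$ on tensors, $\theta(A)\gamma=\theta_s(A)\gamma-\gamma(A\cdot,\dots,\cdot)-\dots-\gamma(\cdot,\dots,A\cdot)$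 with $\theta_s(A)$ the derivation action of $A$ on $T_oM^{\otimes s}$; and 2. $\gamma(t)=c(t)f(t)^*\gamma$ for all $t\in J$, for some $c(t)\in\mathbb R^*$ and *equivariant* diffeomorphisms $f(t)$, i.e. $f(t)(aK)=F_t(a)K$ for all $a\in G$ with $F_t$ an automorphism of the Lie group $G$ such that $F_t(K)=K$; moreover one can take $c(0)=1$ and $f(0)=\mathrm{id}$. -/

import Mathlib

open scoped Manifold ContDiff Topology

noncomputable section

namespace HomSoliton

/-! ### Tensors on a vector space -/

/-- Tensors of type `(r, s)` on a finite-dimensional space `V`, i.e. multilinear maps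
`V × ⋯ × V → V ⊗ ⋯ ⊗ V` (`r` arguments, `s` factors), as real-valued multilinear functions
`γ ξ v` of `s` covectors `ξ` (contracted with the value) and `r` vectors `v` (the arguments). -/
abbrev Tensor (r s : ℕ) (V : Type*) [NormedAddCommGroup V] [NormedSpace ℝ V] : Type _ :=
  ContinuousMultilinearMap ℝ (fun _ : Fin s => V →L[ℝ] ℝ)
    (ContinuousMultilinearMap ℝ (fun _ : Fin r => V) ℝ)

section LinearAlgebra

variable {V W : Type*} [NormedAddCommGroup V] [NormedSpace ℝ V]
  [NormedAddCommGroup W] [NormedSpace ℝ W]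

/-- Pull-back of a tensor on `W` along a linear isomorphism `L : V → W` with inverse `L'`. -/
def Tensor.pull {r s : ℕ} (L : V →L[ℝ] W) (L' : W →L[ℝ] V) (γ : Tensor r s W) : Tensor r s V :=
  (ContinuousMultilinearMap.compContinuousLinearMapL
      (fun _ : Fin r => L)).compContinuousMultilinearMap
    (γ.compContinuousLinearMap fun _ : Fin s => ContinuousLinearMap.precomp ℝ L')

theorem Tensor.pull_apply {r s : ℕ} (L : V →L[ℝ] W) (L' : W →L[ℝ] V) (γ : Tensor r s W)
    (ξ : Fin s → V →L[ℝ] ℝ) (v : Fin r → V) :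
    Tensor.pull L L' γ ξ v = γ (fun j => (ξ j).comp L') (fun i => L (v i)) := rfl

/-- The representation `θ` of `𝔤𝔩(V)` on tensors of type `(r, s)`:
`θ(A)γ = θ_s(A) ∘ γ - γ(A ·, …, ·) - ⋯ - γ(·, …, A ·)`. -/
def Tensor.theta {r s : ℕ} (A : V →L[ℝ] V) (γ : Tensor r s V) : Tensor r s V :=
  (∑ k : Fin s, γ.compContinuousLinearMap
      (fun j : Fin s => if j = k then ContinuousLinearMap.precomp ℝ A
        else ContinuousLinearMap.id ℝ (V →L[ℝ] ℝ))) -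
  ∑ k : Fin r, (ContinuousMultilinearMap.compContinuousLinearMapL
      (fun i : Fin r => if i = k then A
        else ContinuousLinearMap.id ℝ V)).compContinuousMultilinearMap γ

theorem Tensor.theta_apply {r s : ℕ} (A : V →L[ℝ] V) (γ : Tensor r s V)
    (ξ : Fin s → V →L[ℝ] ℝ) (v : Fin r → V) :
    Tensor.theta A γ ξ v =
      (∑ k : Fin s, γ (Function.update ξ k ((ξ k).comp A)) v) -
        ∑ k : Fin r, γ ξ (Function.update v k (A (v k))) := by
  have h1 : ∀ k : Fin s, (fun j : Fin s => (if j = k then ContinuousLinearMap.precomp ℝ A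
        else ContinuousLinearMap.id ℝ (V →L[ℝ] ℝ)) (ξ j)) =
      Function.update ξ k ((ξ k).comp A) := by
    intro k
    funext j
    by_cases h : j = k
    · subst h; simp
    · simp [h]
  have h2 : ∀ k : Fin r, (fun i : Fin r => (if i = k then A
        else ContinuousLinearMap.id ℝ V) (v i)) = Function.update v k (A (v k)) := by
    intro k
    funext j
    by_cases h : j = k
    · subst h; simp
    · simp [h]
  simp [Tensor.theta, h1, h2]

variable {m : ℕ}

/-- Tuples of tensors on `V`, the `i`-th one of type `(r i, s i)`. -/
abbrev Tensors (r s : Fin m → ℕ) (V : Type*) [NormedAddCommGroup V] [NormedSpace ℝ V] : Type _ :=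
  ∀ i, Tensor (r i) (s i) V

instance {r s : Fin m → ℕ} : NormedAddCommGroup (Tensors r s V) := Pi.normedAddCommGroup

instance {r s : Fin m → ℕ} : NormedSpace ℝ (Tensors r s V) := Pi.normedSpace

instance {r s : Fin m → ℕ} : Module ℝ (Tensors r s V) := NormedSpace.toModule

/-- Pull-back of a tuple of tensors. -/
def Tensors.pull {r s : Fin m → ℕ} (L : V →L[ℝ] W) (L' : W →L[ℝ] V) (γ : Tensors r s W) :
    Tensors r s V :=
  fun i => Tensor.pull L L' (γ i)

/-- The representation `θ` of `𝔤𝔩(V)` on tuples of tensors. -/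
def Tensors.theta {r s : Fin m → ℕ} (A : V →L[ℝ] V) (γ : Tensors r s V) : Tensors r s V :=
  fun i => Tensor.theta A (γ i)

/-- `S` is an embedded smooth submanifold of the finite-dimensional vector space `W`: near each of
its points a smooth change of coordinates turns it into a linear subspace. -/
def IsEmbeddedSubmanifold (S : Set W) : Prop :=
  ∀ w ∈ S, ∃ (Φ : OpenPartialHomeomorph W W) (F : Submodule ℝ W), w ∈ Φ.source ∧
    ContDiffOn ℝ ∞ Φ Φ.source ∧ ContDiffOn ℝ ∞ Φ.symm Φ.target ∧
    ∀ x ∈ Φ.source, x ∈ S ↔ Φ x ∈ F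

/-- The tangent vectors at `w` of a subset `S` of a vector space: the velocities of the curves
in `S` through `w`. -/
def tangentVectors (S : Set W) (w : W) : Set W :=
  {u | ∃ σ : ℝ → W, σ 0 = w ∧ (∀ᶠ t in 𝓝 (0 : ℝ), σ t ∈ S) ∧ HasDerivAt σ u 0}

end LinearAlgebra

/-! ### Tensor fields on a manifold -/

section Manifold

variable {n m : ℕ} {r s : Fin m → ℕ}
  {M : Type*} [TopologicalSpace M] [ChartedSpace (EuclideanSpace ℝ (Fin n)) M]

/-- (Not necessarily smooth) tuples of tensor fields on `M`. The tangent space `TangentSpace (𝓡 n) x`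
is by definition the model space `EuclideanSpace ℝ (Fin n)`, so that the value at `x` is a tensor
on the tangent space at `x`. -/
abbrev TensorField (r s : Fin m → ℕ) (n : ℕ) (M : Type*) : Type _ :=
  M → Tensors r s (EuclideanSpace ℝ (Fin n))

/-- The diffeomorphisms of `M`. -/
abbrev Diff (n : ℕ) (M : Type*) [TopologicalSpace M]
    [ChartedSpace (EuclideanSpace ℝ (Fin n)) M] : Type _ :=
  M ≃ₘ^∞⟮𝓡 n, 𝓡 n⟯ M

/-- The differential at `x` of a map between manifolds, as a linear map between the tangent spaces,
which are by definition the model spaces. -/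
def differential {n n' : ℕ}
    {M : Type*} [TopologicalSpace M] [ChartedSpace (EuclideanSpace ℝ (Fin n)) M]
    {M' : Type*} [TopologicalSpace M'] [ChartedSpace (EuclideanSpace ℝ (Fin n')) M']
    (f : M → M') (x : M) : EuclideanSpace ℝ (Fin n) →L[ℝ] EuclideanSpace ℝ (Fin n') :=
  mfderiv (𝓡 n) (𝓡 n') f x

/-- The pull-back `f^*γ` of a tensor field by a diffeomorphism. -/
def pullback (f : Diff n M) (γ : TensorField r s n M) : TensorField r s n M :=
  fun x => Tensors.pull (differential f x) (differential f.symm (f x)) (γ (f x))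

/-- The expression of a tensor field in the chart `φ` centred at `x₀`, i.e. its pull-back by `φ⁻¹`;
a function on the target of `φ`. -/
def localRep (x₀ : M) (γ : TensorField r s n M) :
    EuclideanSpace ℝ (Fin n) → Tensors r s (EuclideanSpace ℝ (Fin n)) :=
  fun y => Tensors.pull
    (differential (extChartAt (𝓡 n) x₀).symm y)
    (differential (extChartAt (𝓡 n) x₀) ((extChartAt (𝓡 n) x₀).symm y))
    (γ ((extChartAt (𝓡 n) x₀).symm y))

/-- Smooth tensor fields. -/
def IsSmooth (γ : TensorField r s n M) : Prop :=
  ∀ x₀ : M, ContDiffOn ℝ ∞ (localRep x₀ γ) (extChartAt (𝓡 n) x₀).target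

/-- Smooth vector fields. -/
def IsSmoothVectorField [IsManifold (𝓡 n) ∞ M] (X : ∀ x : M, TangentSpace (𝓡 n) x) : Prop :=
  ContMDiff (𝓡 n) (𝓡 n).tangent ∞ fun x => (⟨x, X x⟩ : TangentBundle (𝓡 n) M)

/-- The expression of a vector field in the chart centred at `x₀`. -/
def localVectorField (x₀ : M) (X : ∀ x : M, TangentSpace (𝓡 n) x) :
    EuclideanSpace ℝ (Fin n) → EuclideanSpace ℝ (Fin n) :=
  fun y => differential (extChartAt (𝓡 n) x₀) ((extChartAt (𝓡 n) x₀).symm y)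
    (X ((extChartAt (𝓡 n) x₀).symm y))

/-- The Lie derivative `𝓛_X γ`, computed at `x` in the chart `φ` centred at `x`, where it is given
by the coordinate formula `dγ(X) - θ(dX)γ` (derivative of the components of `γ` in the direction
`X`, plus one term `γ(…, dX ·, …)` for each vector argument, minus one term for each factor of
the value), and pulled back by `φ`. -/
def lieDerivative (X : ∀ x : M, TangentSpace (𝓡 n) x) (γ : TensorField r s n M) :
    TensorField r s n M :=
  fun x =>
    let y := extChartAt (𝓡 n) x x
    let Y := localVectorField x X
    Tensors.pull (differential (extChartAt (𝓡 n) x) x)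
      (differential (extChartAt (𝓡 n) x).symm y)
      (fderiv ℝ (localRep x γ) y (Y y) - Tensors.theta (fderiv ℝ Y y) (localRep x γ y))

/-- `q` is a diffeomorphism equivariant assignment of a (smooth) tensor field `q γ`
to each `γ` in the diffeomorphism invariant space `Γ` of (smooth) tensor fields. -/
structure IsPreferredDirection (Γ : Set (TensorField r s n M))
    (q : TensorField r s n M → TensorField r s n M) : Prop where
  smooth : ∀ γ ∈ Γ, IsSmooth γ
  smooth_dir : ∀ γ ∈ Γ, IsSmooth (q γ)
  pullback_mem : ∀ (f : Diff n M), ∀ γ ∈ Γ, pullback f γ ∈ Γ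
  equivariant : ∀ (f : Diff n M), ∀ γ ∈ Γ, q (pullback f γ) = pullback f (q γ)

/-- `γ` is a soliton: `q(γ) = cγ + 𝓛_X γ` for some `c ∈ ℝ` and some smooth vector field `X`. -/
def IsSoliton [IsManifold (𝓡 n) ∞ M] (q : TensorField r s n M → TensorField r s n M)
    (γ : TensorField r s n M) : Prop :=
  ∃ (c : ℝ) (X : ∀ x : M, TangentSpace (𝓡 n) x), IsSmoothVectorField X ∧
    q γ = c • γ + lieDerivative X γ

/-- `(M, γ)` is homogeneous: its automorphism group `{f ∈ Diff(M) : f^*γ = γ}` is transitive. -/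
def IsHomogeneous (γ : TensorField r s n M) : Prop :=
  ∀ x y : M, ∃ f : Diff n M, pullback f γ = γ ∧ f x = y

/-- `γ(t)`, `t ∈ J`, is a solution in `Γ` of the flow `∂γ/∂t = q(γ)`. -/
def IsFlowSolution (Γ : Set (TensorField r s n M))
    (q : TensorField r s n M → TensorField r s n M) (J : Set ℝ)
    (γ : ℝ → TensorField r s n M) : Prop :=
  ∀ t ∈ J, γ t ∈ Γ ∧ ∀ x : M, HasDerivAt (fun u => γ u x) (q (γ t) x) t

/-! ### Lie groups acting on the manifold -/

variable {k : ℕ}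
  (G : Type*) [Group G] [TopologicalSpace G] [ChartedSpace (EuclideanSpace ℝ (Fin k)) G]
  [MulAction G M]

/-- The Lie group `G`, acting on `M`, is the automorphism group `Aut(M, γ)`: it acts effectively,
and the diffeomorphisms preserving `γ` are exactly those given by the elements of `G`. -/
structure IsAutomorphismGroup (γ : TensorField r s n M) : Prop where
  effective : ∀ a b : G, (∀ x : M, a • x = b • x) → a = b
  mem_iff : ∀ f : Diff n M, pullback f γ = γ ↔ ∃ a : G, ∀ x, f x = a • x

/-- `γ` is `G`-invariant: `τ^*γ = γ` for each diffeomorphism `τ` given by an element of `G`. -/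
def IsInvariant (γ : TensorField r s n M) : Prop :=
  ∀ (a : G) (f : Diff n M), (∀ x, f x = a • x) → pullback f γ = γ

/-- The values at the origin `o` of the `G`-invariant structures in `Γ`. If `G` is transitive, this
is `Γ^G` as a subset of a finite-dimensional vector space of tensors. -/
def invariantValues (o : M) (Γ : Set (TensorField r s n M)) :
    Set (Tensors r s (EuclideanSpace ℝ (Fin n))) :=
  {w | ∃ γ ∈ Γ, IsInvariant G γ ∧ γ o = w}

/-- The `G`-invariant structures in `Γ` form a submanifold of the finite-dimensional vector space
of invariant tensors, and `q` is a smooth tangent vector field on it. -/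
def IsSmoothOnInvariants (o : M) (Γ : Set (TensorField r s n M))
    (q : TensorField r s n M → TensorField r s n M) : Prop :=
  IsEmbeddedSubmanifold (invariantValues G o Γ) ∧
  ∃ Q : Tensors r s (EuclideanSpace ℝ (Fin n)) → Tensors r s (EuclideanSpace ℝ (Fin n)),
    ContDiffOn ℝ ∞ Q (invariantValues G o Γ) ∧
    (∀ w ∈ invariantValues G o Γ, Q w ∈ tangentVectors (invariantValues G o Γ) w) ∧
    ∀ γ ∈ Γ, IsInvariant G γ → q γ o = Q (γ o)

/-- `f` is an equivariant diffeomorphism of `M = G/K`, where `K` is the isotropy subgroup at the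
origin `o`: it is given by `f(aK) = F(a)K` for a Lie group automorphism `F` of `G` with
`F(K) = K`. -/
def IsEquivariantDiffeo (o : M) (f : Diff n M) : Prop :=
  ∃ F : G ≃* G, ContMDiff (𝓡 k) (𝓡 k) ∞ F ∧ ContMDiff (𝓡 k) (𝓡 k) ∞ F.symm ∧
    (MulAction.stabilizer G o).map F.toMonoidHom = MulAction.stabilizer G o ∧
    ∀ a : G, f (a • o) = F a • o

instance instLieGroupMinSmoothness [h : LieGroup (𝓡 k) ∞ G] :
    LieGroup (𝓡 k) (minSmoothness ℝ 3) G := by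
  rw [minSmoothness_of_isRCLikeNormedField]
  infer_instance

variable [LieGroup (𝓡 k) ∞ G]

/-- The differential at the identity of the projection `π : G → G/K = M`, `π(a) = a • o`, as a map
from the Lie algebra of `G` to the tangent space of `M` at `o`. -/
def dProj (o : M) : GroupLieAlgebra (𝓡 k) G →L[ℝ] EuclideanSpace ℝ (Fin n) :=
  differential (fun a : G => a • o) (1 : G)

/-- `(G/K, γ)` is a semi-algebraic soliton: `q(γ) = cγ + θ(D_𝔭)γ` at the origin, for some `c ∈ ℝ`
and some derivation `D` of the Lie algebra `𝔤` of `G` which preserves the Lie algebra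
`𝔨 = ker dπ` of `K`, where `D_𝔭` is the operator induced by `D` on `T_oM = 𝔤/𝔨`. -/
def IsSemiAlgebraicSoliton (o : M) (q : TensorField r s n M → TensorField r s n M)
    (γ : TensorField r s n M) : Prop :=
  ∃ (c : ℝ) (D : LieDerivation ℝ (GroupLieAlgebra (𝓡 k) G) (GroupLieAlgebra (𝓡 k) G))
    (Dp : EuclideanSpace ℝ (Fin n) →L[ℝ] EuclideanSpace ℝ (Fin n)),
    (∀ X, dProj (n := n) G o X = 0 → dProj (n := n) G o (D X) = 0) ∧
    (∀ X, Dp (dProj (n := n) G o X) = dProj (n := n) G o (D X)) ∧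
    q γ o = c • γ o + Tensors.theta Dp (γ o)

end Manifold

end HomSoliton

end

/-! Fix `t` and correct `f(t)` by an element of `G` so that it fixes `o`; call the result `f`. Since
`f^*γ` is a multiple of the `G`-invariant field `γ(t)`, each `f a f⁻¹` preserves `γ`, so `f G f⁻¹ ⊂
G`. The reverse inclusion comes from the flow. Pull-back by `f` maps invariant structures to
invariant structures and commutes with `q`. Existence and uniqueness for the ODE on the submanifold
of invariant values then show that the times `u ∈ J` at which `(f⁻¹)^*γ(u)` is invariant form an
open and closed subset of `J` (`isInvariant_pullback_symm`). It contains `t`, where this field is a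
multiple of `γ`, hence also `0`, and this gives `f⁻¹ G f ⊂ G`. Conjugation by `f` is thus an
abstract automorphism of `G`. It is continuous by a closed graph argument and smooth because the
action is effective (`contMDiff_of_normalizes`). This is the equivariance statement.

It follows that `γ(t)` at `o` stays in the orbit of `γ` at `o` under a closed linear group: nonzero
scalars, together with automorphisms of `𝔤` and the operators on `T_oM` compatible with them through
`dπ`. Nothing is known about the dependence of `c(t)` and `f(t)` on `t`, so these cannot be
differentiated. Instead, a `C¹` curve contained in an orbit of a closed linear group is tangent to
the orbit, whatever group elements realise it (`LinearAction.deriv_mem_orbitTangent`). The tangent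
vectors to the orbit are the `cγ + θ(A)γ` with `A` induced by a derivation of `𝔤`
(`exists_derivation_of_orbit`), and the velocity at `t = 0` is `q(γ)`. -/

noncomputable section

namespace HomSoliton

/-! ### Exponentials of operators -/

section Exponential

variable {W : Type*} [NormedAddCommGroup W] [NormedSpace ℝ W] [CompleteSpace W]

theorem hasDerivAt_exp_smul_apply (B : W →L[ℝ] W) (x : W) (t : ℝ) :
    HasDerivAt (fun u : ℝ => NormedSpace.exp (u • B) x) (B (NormedSpace.exp (t • B) x)) t :=
  (hasDerivAt_exp_smul_const' (𝕂 := ℝ) B t).clm_apply (hasDerivAt_const t x) |>.congr_deriv (by simp)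

theorem hasDerivAt_exp_smul_apply' (B : W →L[ℝ] W) (x : W) (t : ℝ) :
    HasDerivAt (fun u : ℝ => NormedSpace.exp (u • B) x) (NormedSpace.exp (t • B) (B x)) t :=
  (hasDerivAt_exp_smul_const (𝕂 := ℝ) B t).clm_apply (hasDerivAt_const t x) |>.congr_deriv (by simp)

/-- The error is relative to `‖B x‖` rather than to `‖B‖`, because `B` may be large compared with
its effect on `x`. It follows from the mean value inequality for `s ↦ exp(sB)x - sBx`, whose
derivative is `(exp(sB) - 1)(B x)`. -/
theorem exists_norm_exp_apply_sub_sub_le {ε : ℝ} (hε : 0 < ε) :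
    ∃ δ > 0, ∀ B : W →L[ℝ] W, ‖B‖ < δ → ∀ x, ‖NormedSpace.exp B x - x - B x‖ ≤ ε * ‖B x‖ := by
  have hc : ContinuousAt (NormedSpace.exp : (W →L[ℝ] W) → (W →L[ℝ] W)) 0 :=
    (hasFDerivAt_exp_zero (𝕂 := ℝ) (𝔸 := W →L[ℝ] W)).continuousAt
  rw [Metric.continuousAt_iff] at hc
  obtain ⟨δ, hδ, h⟩ := hc ε hε
  refine ⟨δ, hδ, fun B hB x => ?_⟩
  have hd : ∀ s ∈ Set.Icc (0 : ℝ) 1, HasDerivWithinAt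
      (fun s : ℝ => NormedSpace.exp (s • B) x - s • B x)
      (NormedSpace.exp (s • B) (B x) - (1 : ℝ) • B x) (Set.Icc 0 1) s := fun s _ =>
    ((hasDerivAt_exp_smul_apply' B x s).sub ((hasDerivAt_id s).smul_const (B x))).hasDerivWithinAt
  have hb : ∀ s ∈ Set.Ico (0 : ℝ) 1,
      ‖NormedSpace.exp (s • B) (B x) - (1 : ℝ) • B x‖ ≤ ε * ‖B x‖ := by
    intro s hs
    have h1 : dist (s • B) 0 < δ := by
      rw [dist_zero_right, norm_smul, Real.norm_of_nonneg hs.1]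
      nlinarith [norm_nonneg B, hs.2]
    have h2 := h h1
    rw [NormedSpace.exp_zero, dist_eq_norm] at h2
    have : NormedSpace.exp (s • B) (B x) - (1 : ℝ) • B x = (NormedSpace.exp (s • B) - 1) (B x) := by
      simp
    rw [this]
    exact ((NormedSpace.exp (s • B) - 1).le_opNorm _).trans (by gcongr)
  have := norm_image_sub_le_of_norm_deriv_le_segment' hd hb 1 (by simp)
  simp only [one_smul, zero_smul, NormedSpace.exp_zero, one_apply_eq_self, sub_zero,
    mul_one] at this
  rwa [sub_right_comm] at this

/-- An operator close to `0` annihilates the vectors fixed by its exponential. -/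
theorem exists_forall_apply_eq_zero_of_exp_apply_eq :
    ∃ δ > 0, ∀ B : W →L[ℝ] W, ‖B‖ < δ → ∀ x, NormedSpace.exp B x = x → B x = 0 := by
  obtain ⟨δ, hδ, h⟩ := exists_norm_exp_apply_sub_sub_le (W := W) (ε := 1 / 2) (by norm_num)
  refine ⟨δ, hδ, fun B hB x hx => ?_⟩
  have := h B hB x
  rw [hx, sub_self, zero_sub, norm_neg] at this
  exact norm_le_zero_iff.1 (by linarith)

/-- Small displacements by exponentials are given by the generators up to a small relative error. -/
theorem tendsto_smul_apply_of_tendsto_smul_exp_apply_sub {ι : Type*} {l : Filter ι}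
    {B : ι → W →L[ℝ] W} (hB : Filter.Tendsto B l (𝓝 0)) {τ : ι → ℝ} {x u : W}
    (h : Filter.Tendsto (fun j => τ j • (NormedSpace.exp (B j) x - x)) l (𝓝 u)) :
    Filter.Tendsto (fun j => τ j • B j x) l (𝓝 u) := by
  have hle : ∀ ε > 0, ∀ᶠ j in l, ‖τ j • (NormedSpace.exp (B j) x - x) - τ j • B j x‖ ≤
      ε * ‖τ j • B j x‖ := by
    intro ε hε
    obtain ⟨δ, hδ, h1⟩ := exists_norm_exp_apply_sub_sub_le (W := W) hε
    have h2 : ∀ᶠ j in l, ‖B j‖ < δ := by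
      have := hB.norm
      rw [norm_zero] at this
      exact this.eventually (gt_mem_nhds hδ)
    filter_upwards [h2] with j hj
    rw [← smul_sub, norm_smul, norm_smul]
    have := mul_le_mul_of_nonneg_left (h1 (B j) hj x) (norm_nonneg (τ j))
    linarith
  -- The relative error `1/2` bounds `τ B x` by twice the convergent displacement. With this bound,
  -- the relative errors become absolute ones.
  have hbound : ∀ᶠ j in l, ‖τ j • B j x‖ ≤ 2 * (‖u‖ + 1) := by
    have h3 : ∀ᶠ j in l, ‖τ j • (NormedSpace.exp (B j) x - x)‖ < ‖u‖ + 1 :=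
      h.norm.eventually (gt_mem_nhds (by linarith))
    filter_upwards [hle (1 / 2) (by norm_num), h3] with j h4 h5
    have := norm_sub_norm_le (τ j • B j x) (τ j • (NormedSpace.exp (B j) x - x))
    rw [norm_sub_rev] at this
    linarith
  have hz : Filter.Tendsto
      (fun j => τ j • (NormedSpace.exp (B j) x - x) - τ j • B j x) l (𝓝 0) := by
    rw [Metric.tendsto_nhds]
    intro ε hε
    have hp : 0 < 2 * (‖u‖ + 1) := by positivity
    filter_upwards [hle (ε / (2 * (2 * (‖u‖ + 1)))) (by positivity), hbound] with j h6 h7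
    rw [dist_zero_right]
    calc _ ≤ _ := h6
      _ ≤ ε / (2 * (2 * (‖u‖ + 1))) * (2 * (‖u‖ + 1)) := by gcongr
      _ = ε / 2 := by field_simp
      _ < ε := by linarith
  simpa using h.sub hz

/-- Elements close to the identity are exponentials of elements close to `0`. -/
theorem exists_tendsto_zero_exp_eq {R : Type*} [NormedRing R] [NormedAlgebra ℝ R] [CompleteSpace R]
    {ι : Type*} {l : Filter ι} {g : ι → R} (hg : Filter.Tendsto g l (𝓝 1)) :
    ∃ A : ι → R, Filter.Tendsto A l (𝓝 0) ∧ ∀ᶠ j in l, NormedSpace.exp (A j) = g j := by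
  have h : HasStrictFDerivAt (NormedSpace.exp : R → R)
      ((ContinuousLinearEquiv.refl ℝ R : R ≃L[ℝ] R) : R →L[ℝ] R) 0 :=
    hasStrictFDerivAt_exp_zero (𝕂 := ℝ)
  refine ⟨fun j => h.localInverse _ _ _ (g j), ?_, ?_⟩
  · have := h.localInverse_tendsto
    rw [NormedSpace.exp_zero] at this
    exact this.comp hg
  · have := h.eventually_right_inverse
    rw [NormedSpace.exp_zero] at this
    exact hg.eventually this

theorem exists_unit_eq_exp {R : Type*} [NormedRing R] [NormedAlgebra ℝ R] [CompleteSpace R] (a : R) :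
    ∃ u : Rˣ, (u : R) = NormedSpace.exp a :=
  letI : NormedAlgebra ℚ R := NormedAlgebra.restrictScalars ℚ ℝ R
  NormedSpace.isUnit_exp a

theorem exp_units_conj {R : Type*} [NormedRing R] [NormedAlgebra ℝ R] [CompleteSpace R] (u : Rˣ)
    (a : R) : NormedSpace.exp (u * a * ↑u⁻¹) = u * NormedSpace.exp a * ↑u⁻¹ :=
  letI : NormedAlgebra ℚ R := NormedAlgebra.restrictScalars ℚ ℝ R
  NormedSpace.exp_units_conj u a

theorem exp_neg_mul_exp {R : Type*} [NormedRing R] [NormedAlgebra ℝ R] [CompleteSpace R] (a : R) :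
    NormedSpace.exp (-a) * NormedSpace.exp a = 1 := by
  let : NormedAlgebra ℚ R := NormedAlgebra.restrictScalars ℚ ℝ R
  rw [← NormedSpace.exp_add_of_commute (Commute.neg_left (Commute.refl a)), neg_add_cancel,
    NormedSpace.exp_zero]

theorem exp_smul_one_add {R : Type*} [NormedRing R] [NormedAlgebra ℝ R] [CompleteSpace R] (c : ℝ)
    (a : R) : NormedSpace.exp (c • 1 + a) = NormedSpace.exp c • NormedSpace.exp a := by
  let : NormedAlgebra ℚ R := NormedAlgebra.restrictScalars ℚ ℝ R
  rw [← Algebra.algebraMap_eq_smul_one, NormedSpace.exp_add_of_commute (Algebra.commutes c a),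
    ← NormedSpace.algebraMap_exp_comm, Algebra.smul_def]

theorem val_inv_eq_exp_neg {R : Type*} [NormedRing R] [NormedAlgebra ℝ R] [CompleteSpace R]
    {u : Rˣ} {a : R} (h : (u : R) = NormedSpace.exp a) : ((u⁻¹ : Rˣ) : R) = NormedSpace.exp (-a) :=
  (Units.eq_inv_of_mul_eq_one_left (by simpa [h] using exp_neg_mul_exp (-a))).symm

theorem exp_apply_of_apply_eq_zero {B : W →L[ℝ] W} {x : W} (h : B x = 0) :
    NormedSpace.exp B x = x := by
  have h1 : ∀ t : ℝ, HasDerivAt (fun u : ℝ => NormedSpace.exp (u • B) x) 0 t := fun t =>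
    (hasDerivAt_exp_smul_apply' B x t).congr_deriv (by rw [h, map_zero])
  have h2 := is_const_of_deriv_eq_zero (fun t => (h1 t).differentiableAt) (fun t => (h1 t).deriv) 1 0
  simpa using h2

/-- If `Φ` is constant along the curves solving `y' = -B y`, then it computes `exp B`. -/
theorem eq_apply_exp_of_hasDerivAt {F : Type*} [NormedAddCommGroup F] [NormedSpace ℝ F]
    {Φ : ℝ → W → F} {B : W →L[ℝ] W}
    (hΦ : ∀ (y : ℝ → W) (t : ℝ), HasDerivAt y (-(B (y t))) t →
      HasDerivAt (fun u => Φ u (y u)) 0 t) (x : W) :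
    Φ 1 x = Φ 0 (NormedSpace.exp B x) := by
  -- This solution runs from `exp B x` at time `0` to `x` at time `1`.
  have hy : ∀ t : ℝ, HasDerivAt (fun u : ℝ => NormedSpace.exp ((1 - u) • B) x)
      (-(B (NormedSpace.exp ((1 - t) • B) x))) t := fun t => by
    have := (hasDerivAt_exp_smul_apply B x (1 - t)).scomp t ((hasDerivAt_id t).const_sub 1)
    exact this.congr_deriv (by simp)
  have hz := fun t => hΦ _ t (hy t)
  have h2 := is_const_of_deriv_eq_zero (fun t => (hz t).differentiableAt) (fun t => (hz t).deriv) 1 0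
  simpa using h2

/-- The space of linear maps as a normed space. -/
def HomSpace (E F : Type*) [NormedAddCommGroup E] [NormedSpace ℝ E] [NormedAddCommGroup F]
    [NormedSpace ℝ F] : Type _ := E →L[ℝ] F

/-! ### Conjugation of linear maps by exponentials -/

section Intertwine

variable {E F : Type*} [NormedAddCommGroup E] [NormedSpace ℝ E] [NormedAddCommGroup F]
    [NormedSpace ℝ F]

instance : NormedAddCommGroup (HomSpace E F) := inferInstanceAs (NormedAddCommGroup (E →L[ℝ] F))

instance : NormedSpace ℝ (HomSpace E F) := inferInstanceAs (NormedSpace ℝ (E →L[ℝ] F))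

instance [FiniteDimensional ℝ E] [FiniteDimensional ℝ F] : FiniteDimensional ℝ (HomSpace E F) :=
  inferInstanceAs (FiniteDimensional ℝ (E →L[ℝ] F))

/-- The operator `S ↦ A ∘ S - S ∘ D` on linear maps. -/
def intertwine : (E →L[ℝ] E) × (F →L[ℝ] F) →L[ℝ] (HomSpace E F →L[ℝ] HomSpace E F) :=
  (ContinuousLinearMap.compL ℝ E F F).comp (ContinuousLinearMap.snd ℝ _ _) -
    (ContinuousLinearMap.compL ℝ E E F).flip.comp (ContinuousLinearMap.fst ℝ _ _)

theorem intertwine_apply (D : E →L[ℝ] E) (A : F →L[ℝ] F) (S : E →L[ℝ] F) :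
    (intertwine (D, A) : HomSpace E F →L[ℝ] HomSpace E F) S = A.comp S - S.comp D := rfl

/-- Along `y' = -(A y - y D)` the product `exp(uA) y exp(-uD)` is constant; compare its values at
`0` and `1`. -/
theorem exp_intertwine_apply [FiniteDimensional ℝ E] [FiniteDimensional ℝ F]
    (D : E →L[ℝ] E) (A : F →L[ℝ] F) (S : E →L[ℝ] F) :
    NormedSpace.exp (intertwine (D, A) : HomSpace E F →L[ℝ] HomSpace E F) S =
      (NormedSpace.exp A).comp (S.comp (NormedSpace.exp (-D))) := by
  have : CompleteSpace E := FiniteDimensional.complete ℝ E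
  have : CompleteSpace F := FiniteDimensional.complete ℝ F
  have : CompleteSpace (HomSpace E F) := FiniteDimensional.complete ℝ _
  have aux : ∀ (y : ℝ → E →L[ℝ] F) (t : ℝ), HasDerivAt y (-(A.comp (y t) - (y t).comp D)) t →
      HasDerivAt (fun u => (NormedSpace.exp (u • A)).comp
        ((y u).comp (NormedSpace.exp (u • (-D))))) 0 t := fun y t hy => by
    refine ((hasDerivAt_exp_smul_const (𝕂 := ℝ) A t).clm_comp (hy.clm_comp
      (hasDerivAt_exp_smul_const' (𝕂 := ℝ) (-D) t))).congr_deriv ?_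
    ext v
    simp
    abel
  have h := eq_apply_exp_of_hasDerivAt (W := HomSpace E F) (F := E →L[ℝ] F)
    (Φ := fun u S => (NormedSpace.exp (u • A)).comp
      (ContinuousLinearMap.comp (S : E →L[ℝ] F) (NormedSpace.exp (u • (-D)))))
    (B := intertwine (D, A)) aux S
  simp only [one_smul, zero_smul, NormedSpace.exp_zero] at h
  exact h.symm

end Intertwine

end Exponential

/-! ### The action of linear isomorphisms on tensors -/

section TensorAction

/-- Product rule with both the map and its arguments varying. Vectors are read as linear maps from
`ℝ`, so that this becomes the derivative of a precomposition, evaluated at `(1, …, 1)`. -/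
theorem hasDerivAt_continuousMultilinearMap_apply {ι : Type*} [Fintype ι] [DecidableEq ι]
    {E : ι → Type*} {F : Type*}
    [∀ i, NormedAddCommGroup (E i)] [∀ i, NormedSpace ℝ (E i)]
    [NormedAddCommGroup F] [NormedSpace ℝ F] {f : ℝ → ContinuousMultilinearMap ℝ E F}
    {f' : ContinuousMultilinearMap ℝ E F} {g : ∀ i, ℝ → E i} {g' : ∀ i, E i} {t : ℝ}
    (hf : HasDerivAt f f' t) (hg : ∀ i, HasDerivAt (g i) (g' i) t) :
    HasDerivAt (fun u => f u (fun i => g i u))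
      (f' (fun i => g i t) + ∑ i, f t (Function.update (fun i => g i t) i (g' i))) t := by
  have hg1 : ∀ i, HasFDerivAt (fun u => ContinuousLinearMap.toSpanSingleton ℝ (g i u))
      (((ContinuousLinearMap.toSpanSingletonCLE (𝕜 := ℝ) (E := E i)) :
        E i →L[ℝ] ℝ →L[ℝ] E i).comp (ContinuousLinearMap.toSpanSingleton ℝ (g' i))) t := fun i =>
    ((ContinuousLinearMap.toSpanSingletonCLE (𝕜 := ℝ) (E := E i)) :
        E i →L[ℝ] ℝ →L[ℝ] E i).hasFDerivAt.comp t (hg i).hasFDerivAt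
  have h := (ContinuousMultilinearMap.apply ℝ (fun _ : ι => ℝ) F (fun _ => (1 : ℝ))).hasFDerivAt
    |>.comp_hasDerivAt t (HasFDerivAt.continuousMultilinearMapCompContinuousLinearMap
      hf.hasFDerivAt hg1).hasDerivAt
  refine (h.congr_deriv ?_).congr_of_eventuallyEq (Filter.Eventually.of_forall fun u => ?_)
  · have : ∀ i, (fun j => (Function.update (fun i => ContinuousLinearMap.toSpanSingleton ℝ (g i t)) i
        (ContinuousLinearMap.toSpanSingletonCLE (𝕜 := ℝ) (g' i)) j) (1 : ℝ)) =
        Function.update (fun i => g i t) i (g' i) := by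
      intro i
      funext j
      by_cases hj : j = i
      · subst hj; simp
      · simp [hj]
    simp [this]
  · simp

instance {ι F : Type*} {E : ι → Type*} [Finite ι]
    [∀ i, NormedAddCommGroup (E i)] [∀ i, NormedSpace ℝ (E i)]
    [∀ i, FiniteDimensional ℝ (E i)] [NormedAddCommGroup F] [NormedSpace ℝ F] [FiniteDimensional ℝ F] :
    FiniteDimensional ℝ (ContinuousMultilinearMap ℝ E F) :=
  Module.Finite.of_injective
      (ContinuousMultilinearMap.toMultilinearMapLinear (R' := ℝ) (A := ℝ) (M₁ := E) (M₂ := F))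
      ContinuousMultilinearMap.toMultilinearMap_injective

variable {m : ℕ} {r s : Fin m → ℕ} {U V W : Type*} [NormedAddCommGroup V] [NormedSpace ℝ V]
  [NormedAddCommGroup W] [NormedSpace ℝ W] [NormedAddCommGroup U] [NormedSpace ℝ U]

instance [FiniteDimensional ℝ V] : FiniteDimensional ℝ (Tensors r s V) :=
  inferInstanceAs (FiniteDimensional ℝ (∀ i, Tensor (r i) (s i) V))

theorem Tensors.pull_pull (L : V →L[ℝ] W) (L' : W →L[ℝ] V) (N : U →L[ℝ] V)
    (N' : V →L[ℝ] U) (γ : Tensors r s W) :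
    Tensors.pull N N' (Tensors.pull L L' γ) = Tensors.pull (L.comp N) (N'.comp L') γ := rfl

@[simp] theorem Tensors.pull_id (γ : Tensors r s V) :
    Tensors.pull (ContinuousLinearMap.id ℝ V) (ContinuousLinearMap.id ℝ V) γ = γ := by
  funext i
  ext ξ v
  rfl

/-- The space of tuples of tensors as a normed space. -/
def TensorSpace (r s : Fin m → ℕ) (V : Type*) [NormedAddCommGroup V] [NormedSpace ℝ V] : Type _ :=
  Tensors r s V

instance : NormedAddCommGroup (TensorSpace r s V) :=
  inferInstanceAs (NormedAddCommGroup (Tensors r s V))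

instance : NormedSpace ℝ (TensorSpace r s V) := inferInstanceAs (NormedSpace ℝ (Tensors r s V))

instance [FiniteDimensional ℝ V] : FiniteDimensional ℝ (TensorSpace r s V) :=
  inferInstanceAs (FiniteDimensional ℝ (Tensors r s V))

/-- The pull-back of tensors as a linear map. -/
def Tensors.pullₗ (r s : Fin m → ℕ) (L : V →L[ℝ] W) (L' : W →L[ℝ] V) :
    TensorSpace r s W →ₗ[ℝ] TensorSpace r s V where
  toFun := Tensors.pull L L'
  map_add' _ _ := funext fun i => by ext ξ v; rfl
  map_smul' _ _ := funext fun i => by ext ξ v; rfl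

theorem Tensors.pull_smul (L : V →L[ℝ] W) (L' : W →L[ℝ] V) (c : ℝ) (γ : Tensors r s W) :
    Tensors.pull L L' (c • γ) = c • Tensors.pull L L' γ :=
  map_smul (Tensors.pullₗ r s L L') c γ

theorem continuous_compContinuousMultilinearMap {X ι F F' : Type*} {E : ι → Type*} [Fintype ι]
    [TopologicalSpace X] [∀ i, NormedAddCommGroup (E i)] [∀ i, NormedSpace ℝ (E i)]
    [NormedAddCommGroup F] [NormedSpace ℝ F] [NormedAddCommGroup F'] [NormedSpace ℝ F']
    {f : X → F →L[ℝ] F'} {g : X → ContinuousMultilinearMap ℝ E F} (hf : Continuous f)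
    (hg : Continuous g) : Continuous fun x => (f x).compContinuousMultilinearMap (g x) :=
  ((ContinuousLinearMap.compContinuousMultilinearMapL ℝ E F F').continuous.comp hf).clm_apply hg

theorem Tensor.continuous_pull {r s : ℕ} (γ : Tensor r s W) :
    Continuous fun p : (V →L[ℝ] W) × (W →L[ℝ] V) => Tensor.pull p.1 p.2 γ := by
  refine continuous_compContinuousMultilinearMap ?_ ?_
  · exact (ContinuousMultilinearMap.compContinuousLinearMapContinuousMultilinear ℝ
      (fun _ : Fin r => V) (fun _ => W) ℝ).cont.comp (continuous_pi fun _ => continuous_fst)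
  · refine (ContinuousMultilinearMap.compContinuousLinearMapLRight
      (E := fun _ : Fin s => V →L[ℝ] ℝ) γ).cont.comp (continuous_pi fun _ => ?_)
    exact (ContinuousLinearMap.compL ℝ W V ℝ).flip.continuous.comp
      (continuous_snd (X := V →L[ℝ] W) (Y := W →L[ℝ] V))

theorem Tensors.continuous_pull (γ : Tensors r s W) :
    Continuous fun p : (V →L[ℝ] W) × (W →L[ℝ] V) => Tensors.pull p.1 p.2 γ :=
  continuous_pi fun i => Tensor.continuous_pull (γ i)

/-- The representation `θ` as a bilinear map. -/
def Tensor.thetaₗ (r s : ℕ) (V : Type*) [NormedAddCommGroup V] [NormedSpace ℝ V] :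
    (V →L[ℝ] V) →ₗ[ℝ] Tensor r s V →ₗ[ℝ] Tensor r s V :=
  LinearMap.mk₂ ℝ Tensor.theta
    (fun A B γ => by
      ext ξ v
      simp only [Tensor.theta_apply, add_apply,
        ContinuousLinearMap.comp_add,
        ContinuousMultilinearMap.map_update_add, Finset.sum_add_distrib]
      ring)
    (fun c A γ => by
      ext ξ v
      simp only [Tensor.theta_apply, smul_apply,
        ContinuousLinearMap.comp_smul,
        ContinuousMultilinearMap.map_update_smul, ← Finset.smul_sum, smul_sub])
    (fun A γ γ' => by
      ext ξ v
      simp only [Tensor.theta_apply, add_apply, Finset.sum_add_distrib]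
      ring)
    (fun c A γ => by
      ext ξ v
      simp only [Tensor.theta_apply, smul_apply, ← Finset.smul_sum,
        smul_sub])

/-- The representation `θ` as a bilinear map. -/
def Tensors.thetaₗ (r s : Fin m → ℕ) (V : Type*) [NormedAddCommGroup V] [NormedSpace ℝ V] :
    (V →L[ℝ] V) →ₗ[ℝ] TensorSpace r s V →ₗ[ℝ] TensorSpace r s V :=
  LinearMap.mk₂ ℝ (M := V →L[ℝ] V) (Nₗ := TensorSpace r s V) (Pₗ := TensorSpace r s V)
    Tensors.theta
    (fun A B γ => funext fun i => (Tensor.thetaₗ (r i) (s i) V).map_add₂ A B (γ i))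
    (fun c A γ => funext fun i => (Tensor.thetaₗ (r i) (s i) V).map_smul₂ c A (γ i))
    (fun A γ γ' => funext fun i => (Tensor.thetaₗ (r i) (s i) V A).map_add (γ i) (γ' i))
    (fun c A γ => funext fun i => (Tensor.thetaₗ (r i) (s i) V A).map_smul c (γ i))

/-- The representation `θ` as a continuous bilinear map. -/
def thetaL (r s : Fin m → ℕ) (V : Type*) [NormedAddCommGroup V] [NormedSpace ℝ V]
    [FiniteDimensional ℝ V] : (V →L[ℝ] V) →L[ℝ] TensorSpace r s V →L[ℝ] TensorSpace r s V :=
  LinearMap.toContinuousLinearMap ((LinearMap.toContinuousLinearMap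
    (E := TensorSpace r s V) (F' := TensorSpace r s V)).toLinearMap ∘ₗ Tensors.thetaₗ r s V)

/-- Differentiating the exponentials in the covector and vector slots produces the terms of `θ(A)`,
which cancel against `y' = -θ(A)y`. -/
theorem Tensor.hasDerivAt_pull_exp [CompleteSpace V] {r s : ℕ} (A : V →L[ℝ] V)
    {y : ℝ → Tensor r s V} {t : ℝ} (hy : HasDerivAt y (-(Tensor.theta A (y t))) t)
    (ξ : Fin s → V →L[ℝ] ℝ) (v : Fin r → V) :
    HasDerivAt (fun u => y u (fun j => (ξ j).comp (NormedSpace.exp (u • A)))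
      (fun j => NormedSpace.exp (u • (-A)) (v j))) 0 t := by
  have hξ : ∀ (j : Fin s), HasDerivAt
      (fun u : ℝ => (ξ j).comp (NormedSpace.exp (u • A)))
      (((ξ j).comp (NormedSpace.exp (t • A))).comp A) t := fun j => by
    have := (hasDerivAt_const t (ξ j)).clm_comp (hasDerivAt_exp_smul_const (𝕂 := ℝ) A t)
    exact this.congr_deriv (by simp; rfl)
  have hv : ∀ (j : Fin r), HasDerivAt
      (fun u : ℝ => NormedSpace.exp (u • (-A)) (v j))
      (-(A (NormedSpace.exp (t • (-A)) (v j)))) t := fun j => by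
    exact (hasDerivAt_exp_smul_apply (-A) (v j) t).congr_deriv (by simp)
  have h1 := hasDerivAt_continuousMultilinearMap_apply hy hξ
  have h2 := hasDerivAt_continuousMultilinearMap_apply h1 hv
  refine h2.congr_deriv ?_
  rw [add_apply, neg_apply, neg_apply, Tensor.theta_apply, sum_apply]
  have h3 : ∀ (f : ContinuousMultilinearMap ℝ (fun _ : Fin r => V) ℝ) (w : Fin r → V) (j : Fin r)
      (x : V), f (Function.update w j (-x)) = -f (Function.update w j x) :=
    fun f => f.toMultilinearMap.map_update_neg
  simp only [h3, Finset.sum_neg_distrib]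
  ring

/-- The action of `exp A` on tensors is the exponential of `θ(A)`. -/
theorem pull_exp [FiniteDimensional ℝ V] (A : V →L[ℝ] V) (γ : Tensors r s V) :
    Tensors.pull (NormedSpace.exp (-A)) (NormedSpace.exp A) γ =
      NormedSpace.exp (thetaL r s V A) γ := by
  have : CompleteSpace V := FiniteDimensional.complete ℝ V
  have : CompleteSpace (TensorSpace r s V) := FiniteDimensional.complete ℝ _
  funext i
  ext ξ v
  have h2 := eq_apply_exp_of_hasDerivAt (W := TensorSpace r s V) (F := ℝ)
    (Φ := fun u (γ : Tensors r s V) => γ i (fun j => (ξ j).comp (NormedSpace.exp (u • A)))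
      (fun j => NormedSpace.exp (u • (-A)) (v j)))
    (B := thetaL r s V A)
    (fun y t hy => Tensor.hasDerivAt_pull_exp A (hasDerivAt_pi.1 hy i) ξ v) γ
  simp only [one_smul, zero_smul, NormedSpace.exp_zero] at h2
  exact h2

end TensorAction

/-! ### Curves in orbits of linear groups -/

section Orbit

variable {R : Type*} [NormedRing R] [NormedAlgebra ℝ R]
  {W : Type*} [NormedAddCommGroup W] [NormedSpace ℝ W]

/-- A representation of the group of units of the algebra `R` on `W`, with its differential, a
closed subgroup of the group of units, and its Lie algebra. -/
structure LinearAction (R W : Type*) [NormedRing R] [NormedAlgebra ℝ R]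
    [NormedAddCommGroup W] [NormedSpace ℝ W] where
  /-- the representation -/
  rep : Rˣ →* (W →L[ℝ] W)
  /-- its differential -/
  drep : R →L[ℝ] (W →L[ℝ] W)
  /-- the group -/
  grp : Subgroup Rˣ
  /-- its Lie algebra -/
  alg : Submodule ℝ R
  continuous_rep : Continuous rep
  rep_exp : ∀ (u : Rˣ) (a : R), (u : R) = NormedSpace.exp a → rep u = NormedSpace.exp (drep a)
  isClosed_grp : IsClosed (grp : Set Rˣ)
  exp_mem : ∀ a ∈ alg, ∀ u : Rˣ, (u : R) = NormedSpace.exp a → u ∈ grp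
  mem_of_exp_mem : ∀ᶠ a in 𝓝 (0 : R), ∀ u ∈ grp, (u : R) = NormedSpace.exp a → a ∈ alg

namespace LinearAction

variable (A : LinearAction R W)

/-- The differential of the orbit map at the identity. -/
def orbitMap (x : W) : R →ₗ[ℝ] W :=
  ((ContinuousLinearMap.apply ℝ W x).comp A.drep : R →L[ℝ] W)

@[simp] theorem orbitMap_apply (x : W) (a : R) : A.orbitMap x a = A.drep a x := rfl

/-- The tangent space to the orbit of `x`. -/
def orbitTangent (x : W) : Submodule ℝ W := A.alg.map (A.orbitMap x)

variable [FiniteDimensional ℝ R]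

/-- The algebra is recognised only through exponentials of small elements: `a` is first multiplied
by a small `s ≠ 0`, and the result is divided by `s` at the end. -/
theorem conj_mem {h : Rˣ} (hh : h ∈ A.grp) {a : R} (ha : a ∈ A.alg) : h * a * h⁻¹ ∈ A.alg := by
  have : CompleteSpace R := FiniteDimensional.complete ℝ R
  have ht : Filter.Tendsto (fun s : ℝ => s • ((h : R) * a * ↑h⁻¹)) (𝓝 0) (𝓝 0) := by
    have : Continuous (fun s : ℝ => s • ((h : R) * a * ↑h⁻¹)) := by fun_prop
    simpa using this.tendsto 0
  obtain ⟨s, hs0, hs⟩ := ((ht.eventually A.mem_of_exp_mem).filter_mono nhdsWithin_le_nhds |>.and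
    (self_mem_nhdsWithin (s := {(0 : ℝ)}ᶜ))).exists
  obtain ⟨u, hu⟩ := exists_unit_eq_exp (s • a)
  have h1 : u ∈ A.grp := A.exp_mem _ (A.alg.smul_mem s ha) u hu
  have h2 := hs0 (h * u * h⁻¹) (A.grp.mul_mem (A.grp.mul_mem hh h1) (A.grp.inv_mem hh)) (by
    rw [Units.val_mul, Units.val_mul, hu, ← HomSoliton.exp_units_conj]
    congr 1
    simp)
  have h3 := A.alg.smul_mem s⁻¹ h2
  rwa [smul_smul, inv_mul_cancel₀ hs, one_smul] at h3

variable [FiniteDimensional ℝ W]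

theorem drep_conj (h : Rˣ) (a : R) :
    A.drep (h * a * h⁻¹) = A.rep h * A.drep a * A.rep h⁻¹ := by
  have : CompleteSpace R := FiniteDimensional.complete ℝ R
  have : CompleteSpace W := FiniteDimensional.complete ℝ W
  have key : ∀ s : ℝ, NormedSpace.exp (s • A.drep (h * a * h⁻¹)) =
      A.rep h * NormedSpace.exp (s • A.drep a) * A.rep h⁻¹ := by
    intro s
    obtain ⟨u, hu⟩ := exists_unit_eq_exp (s • a)
    rw [← map_smul, ← map_smul, ← A.rep_exp u _ hu, ← map_mul, ← map_mul]
    refine (A.rep_exp _ _ ?_).symm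
    rw [Units.val_mul, Units.val_mul, hu, ← HomSoliton.exp_units_conj]
    congr 1
    simp
  have d1 := hasDerivAt_exp_smul_const (𝕂 := ℝ) (A.drep (h * a * h⁻¹)) 0
  have d2 := ((hasDerivAt_exp_smul_const (𝕂 := ℝ) (A.drep a) 0).const_mul (A.rep h)).mul_const
    (A.rep h⁻¹)
  rw [funext key] at d1
  simpa using d1.unique d2

/-- By `drep_conj`, the tangent space at `rep h x` lies in the image under `rep h` of the tangent
space at `x`. -/
theorem finrank_orbitTangent_le {h : Rˣ} (hh : h ∈ A.grp) (x : W) :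
    Module.finrank ℝ (A.orbitTangent (A.rep h x)) ≤ Module.finrank ℝ (A.orbitTangent x) := by
  have : A.orbitTangent (A.rep h x) ≤ (A.orbitTangent x).map (A.rep h : W →ₗ[ℝ] W) := by
    rintro _ ⟨a, ha, rfl⟩
    refine ⟨_, ⟨_, A.conj_mem (A.grp.inv_mem hh) ha, rfl⟩, ?_⟩
    have h1 := A.drep_conj h⁻¹ a
    have h2 : A.rep h * A.rep h⁻¹ = 1 := by rw [← map_mul, mul_inv_cancel, map_one]
    simp only [orbitMap_apply, h1, ContinuousLinearMap.coe_coe]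
    rw [inv_inv]
    calc _ = (A.rep h * A.rep h⁻¹) (A.drep a (A.rep h x)) := rfl
      _ = _ := by rw [h2]; rfl
  exact (Submodule.finrank_mono this).trans (Submodule.finrank_map_le _ _)

/-- Limits of rescaled displacements by group elements tending to the identity are tangent to the
orbit. -/
theorem mem_orbitTangent_of_tendsto {ι : Type*} {l : Filter ι} [l.NeBot] {g : ι → Rˣ}
    (hg : Filter.Tendsto g l (𝓝 1)) (hgH : ∀ᶠ j in l, g j ∈ A.grp) {τ : ι → ℝ} {x u : W}
    (hu : Filter.Tendsto (fun j => τ j • (A.rep (g j) x - x)) l (𝓝 u)) :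
    u ∈ A.orbitTangent x := by
  have : CompleteSpace R := FiniteDimensional.complete ℝ R
  have : CompleteSpace W := FiniteDimensional.complete ℝ W
  obtain ⟨a, ha, hexp⟩ := exists_tendsto_zero_exp_eq ((Units.continuous_val.tendsto 1).comp hg)
  have hB : Filter.Tendsto (fun j => A.drep (a j)) l (𝓝 0) := by
    simpa [Function.comp_def] using (A.drep.continuous.tendsto 0).comp ha
  have h1 : Filter.Tendsto (fun j => τ j • (NormedSpace.exp (A.drep (a j)) x - x)) l (𝓝 u) := by
    refine hu.congr' ?_
    filter_upwards [hexp] with j hj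
    rw [A.rep_exp (g j) (a j) hj.symm]
  have h2 := tendsto_smul_apply_of_tendsto_smul_exp_apply_sub hB h1
  refine (A.orbitTangent x).closed_of_finiteDimensional.mem_of_tendsto h2 ?_
  filter_upwards [ha.eventually A.mem_of_exp_mem, hgH, hexp] with j h3 h4 h5
  exact (A.orbitTangent x).smul_mem _ ⟨a j, h3 _ h4 h5.symm, rfl⟩

/-- A differentiable curve contained in an orbit is tangent to the orbit at some point of each
interval. -/
theorem exists_mem_orbitTangent {x x' : ℝ → W} {x₀ : W} {a b : ℝ} (hab : a < b)
    (hx : ∀ t ∈ Set.Icc a b, HasDerivAt x (x' t) t)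
    (horb : ∀ t ∈ Set.Icc a b, ∃ h ∈ A.grp, x t = A.rep h x₀) :
    ∃ t ∈ Set.Icc a b, x' t ∈ A.orbitTangent (x t) := by
  have : ProperSpace R := FiniteDimensional.proper ℝ R
  have : SecondCountableTopology R := inferInstance
  have : SecondCountableTopology Rᵐᵒᵖ := MulOpposite.opHomeomorph.symm.isEmbedding.secondCountableTopology
  have : SecondCountableTopology Rˣ := Units.isEmbedding_embedProduct.secondCountableTopology
  let K : CompactExhaustion Rˣ := default
  have hcov : Set.Icc a b ⊆ ⋃ N, {t ∈ Set.Icc a b | ∃ h ∈ A.grp, h ∈ K N ∧ x t = A.rep h x₀} := by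
    intro t ht
    obtain ⟨h, hh, hxt⟩ := horb t ht
    obtain ⟨N, hN⟩ := K.exists_mem h
    exact Set.mem_iUnion.2 ⟨N, ht, h, hh, hN, hxt⟩
  -- The interval is uncountable and the compact pieces of the group are countably many, so one
  -- piece serves infinitely many times. These accumulate at some `t₀`.
  obtain ⟨N, hN⟩ : ∃ N, {t ∈ Set.Icc a b | ∃ h ∈ A.grp, h ∈ K N ∧ x t = A.rep h x₀}.Infinite := by
    by_contra! hfin
    have : (Set.Icc a b).Countable :=
      (Set.countable_iUnion fun N => (hfin N).countable).mono hcov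
    exact (Cardinal.Real.Icc_countable_iff.1 this).not_gt hab
  obtain ⟨t₀, ht₀, hacc⟩ := hN.exists_accPt_of_subset_isCompact isCompact_Icc (Set.sep_subset _ _)
  refine ⟨t₀, ht₀, ?_⟩
  rw [accPt_iff_frequently] at hacc
  obtain ⟨t, ht, htS⟩ := Filter.exists_seq_forall_of_frequently hacc
  choose htne htI h hhH hhK hxh using htS
  -- By compactness the group elements converge along a subsequence to some `g`, which represents `x
  -- t₀`. The quotients `h g⁻¹` then tend to `1` and move `x t₀` to the nearby points of the curve.
  obtain ⟨g, hgK, φ, hφ, hlim⟩ := (K.isCompact N).tendsto_subseq hhK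
  have htφ : Filter.Tendsto (t ∘ φ) Filter.atTop (𝓝 t₀) := ht.comp hφ.tendsto_atTop
  have hgH : g ∈ A.grp := A.isClosed_grp.mem_of_tendsto hlim (Filter.Eventually.of_forall fun j => hhH _)
  have hxg : x t₀ = A.rep g x₀ := by
    have h1 : Filter.Tendsto (fun j => x (t (φ j))) Filter.atTop (𝓝 (x t₀)) :=
      ((hx t₀ ht₀).continuousAt.tendsto).comp htφ
    have h2 : Filter.Tendsto (fun j => A.rep (h (φ j)) x₀) Filter.atTop (𝓝 (A.rep g x₀)) :=
      (((A.continuous_rep.clm_apply continuous_const).tendsto g).comp hlim)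
    refine tendsto_nhds_unique h1 (h2.congr fun j => (hxh _).symm)
  refine A.mem_orbitTangent_of_tendsto (l := Filter.atTop) (g := fun j => h (φ j) * g⁻¹)
    (τ := fun j => (t (φ j) - t₀)⁻¹) ?_ ?_ ?_
  · have := hlim.mul_const g⁻¹
    rwa [mul_inv_cancel] at this
  · exact Filter.Eventually.of_forall fun j => A.grp.mul_mem (hhH _) (A.grp.inv_mem hgH)
  · have h1 := (hasDerivAt_iff_tendsto_slope.1 (hx t₀ ht₀)).comp
      (tendsto_nhdsWithin_iff.2 ⟨htφ, Filter.Eventually.of_forall fun j => htne _⟩)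
    refine h1.congr fun j => ?_
    have h2 : A.rep (h (φ j) * g⁻¹) (x t₀) = x (t (φ j)) := by
      rw [hxg, hxh, ← mul_apply_eq_comp, ← map_mul, inv_mul_cancel_right]
    simp only [Function.comp_apply, slope, vsub_eq_sub, h2]

/-- A continuously differentiable curve contained in an orbit is tangent to the orbit. -/
theorem deriv_mem_orbitTangent {x x' : ℝ → W} {J : Set ℝ} (hJ : IsOpen J) {t₀ : ℝ} (ht₀ : t₀ ∈ J)
    (hx : ∀ t ∈ J, HasDerivAt x (x' t) t) (hx' : ContinuousAt x' t₀)
    (horb : ∀ t ∈ J, ∃ h ∈ A.grp, x t = A.rep h (x t₀)) :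
    x' t₀ ∈ A.orbitTangent (x t₀) := by
  by_contra hu
  obtain ⟨S, hS⟩ := ((A.orbitMap (x t₀)).submoduleMap A.alg).exists_rightInverse_of_surjective
    (LinearMap.range_eq_top.2 (LinearMap.submoduleMap_surjective _ _))
  have hS' : ∀ y : A.orbitTangent (x t₀), A.orbitMap (x t₀) (S y) = y := fun y =>
    congrArg Subtype.val (LinearMap.congr_fun hS y)
  let S' : A.orbitTangent (x t₀) →L[ℝ] R := (A.alg.subtype ∘ₗ S).toContinuousLinearMap
  -- `S` is a linear section of the orbit map at `x t₀`, so `L t₀ (y, s) = y + s x'(t₀)`. This is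
  -- injective when `x'(t₀)` is not tangent, and injectivity persists for nearby `t`.
  let L : ℝ → (A.orbitTangent (x t₀) × ℝ →L[ℝ] W) := fun t =>
    (((ContinuousLinearMap.apply ℝ W (x t)).comp A.drep).comp S').comp
      (ContinuousLinearMap.fst ℝ _ _) +
    (ContinuousLinearMap.snd ℝ (A.orbitTangent (x t₀)) ℝ).smulRight (x' t)
  have hL : ∀ t v, L t v = A.orbitMap (x t) (S v.1) + v.2 • x' t := fun t v => rfl
  have hLc : ContinuousAt L t₀ := by
    have h1 : ContinuousAt x t₀ := (hx t₀ ht₀).continuousAt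
    refine ContinuousAt.add ?_ ?_
    · refine ContinuousAt.clm_comp (ContinuousAt.clm_comp (ContinuousAt.clm_comp ?_
        continuousAt_const) continuousAt_const) continuousAt_const
      exact (ContinuousLinearMap.apply ℝ W).continuous.continuousAt.comp h1
    · exact (ContinuousLinearMap.smulRightL ℝ _ W
        (ContinuousLinearMap.snd ℝ (A.orbitTangent (x t₀)) ℝ)).continuous.continuousAt.comp hx'
  have hLinj : Function.Injective (L t₀) := by
    rw [injective_iff_map_eq_zero]
    rintro ⟨y, s⟩ h0
    rw [hL, hS'] at h0
    have hs : s = 0 := by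
      by_contra hs
      apply hu
      have : x' t₀ = -(s⁻¹ • (y : W)) := by
        rw [← eq_neg_iff_add_eq_zero] at h0
        simp only at h0
        rw [h0, smul_neg, neg_neg, smul_smul, inv_mul_cancel₀ hs, one_smul]
      rw [this]
      exact neg_mem (Submodule.smul_mem _ _ y.2)
    subst hs
    simp only [zero_smul, add_zero, ZeroMemClass.coe_eq_zero] at h0
    rw [h0, Prod.mk_zero_zero]
  have hev : ∀ᶠ t in 𝓝 t₀, Function.Injective (L t) ∧ t ∈ J :=
    (hLc.eventually (ContinuousLinearMap.isOpen_injective.mem_nhds hLinj)).and (hJ.mem_nhds ht₀)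
  obtain ⟨ε, hε, hball⟩ := Metric.eventually_nhds_iff_ball.1 hev
  have hsub : Set.Icc (t₀ - ε / 2) (t₀ + ε / 2) ⊆ Metric.ball t₀ ε := by
    rw [Real.ball_eq_Ioo]
    exact Set.Icc_subset_Ioo (by linarith) (by linarith)
  obtain ⟨t, ht, htan⟩ := A.exists_mem_orbitTangent (x₀ := x t₀) (by linarith)
    (fun t ht => hx t (hball t (hsub ht)).2) (fun t ht => horb t (hball t (hsub ht)).2)
  obtain ⟨h, hh, hxt⟩ := horb t (hball t (hsub ht)).2
  -- At a nearby time `t` of tangency, the image of `L t` lies in the tangent space to the orbit at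
  -- `x t`. Its dimension would exceed that at `x t₀`, although both points lie in one orbit.
  have h1 : Module.finrank ℝ (A.orbitTangent (x t₀) × ℝ) ≤
      Module.finrank ℝ (A.orbitTangent (x t)) := by
    refine LinearMap.finrank_le_finrank_of_injective
      (f := LinearMap.codRestrict (A.orbitTangent (x t)) (L t : _ →ₗ[ℝ] W) ?_) ?_
    · intro v
      rw [ContinuousLinearMap.coe_coe, hL]
      exact add_mem ⟨_, (S v.1).2, rfl⟩ (Submodule.smul_mem _ _ htan)
    · exact (LinearMap.injective_codRestrict_iff _).2 (hball t (hsub ht)).1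
  have h3 := A.finrank_orbitTangent_le hh (x t₀)
  rw [← hxt] at h3
  simp only [Module.finrank_prod, Module.finrank_self] at h1
  omega

end LinearAction

end Orbit

/-! ### The automorphism group of a homogeneous structure acting on tensors -/

section HomogeneousAction

variable {m : ℕ} {r s : Fin m → ℕ} {E V : Type*}
  [NormedAddCommGroup E] [NormedSpace ℝ E] [NormedAddCommGroup V] [NormedSpace ℝ V]

/-- The algebra acting on the scalars, on `E` and on `V`. -/
abbrev ScalarEndEnd (E V : Type*) [NormedAddCommGroup E] [NormedSpace ℝ E]
    [NormedAddCommGroup V] [NormedSpace ℝ V] : Type _ := ℝ × (E →L[ℝ] E) × (V →L[ℝ] V)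

theorem exp_scalarEndEnd [CompleteSpace E] [CompleteSpace V] (a : ScalarEndEnd E V) :
    NormedSpace.exp a = (NormedSpace.exp a.1, NormedSpace.exp a.2.1, NormedSpace.exp a.2.2) := by
  let : NormedAlgebra ℚ (E →L[ℝ] E) := NormedAlgebra.restrictScalars ℚ ℝ _
  let : NormedAlgebra ℚ (V →L[ℝ] V) := NormedAlgebra.restrictScalars ℚ ℝ _
  ext1
  · exact Prod.fst_exp a
  · rw [Prod.snd_exp]
    ext1
    · exact Prod.fst_exp a.2
    · exact Prod.snd_exp a.2

section Units

variable (h k : (ScalarEndEnd E V)ˣ)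

theorem units_snd_mul_inv :
    h.val.2.1.comp (h⁻¹).val.2.1 = .id ℝ E :=
  congrArg (fun a : ScalarEndEnd E V => a.2.1) h.mul_inv

theorem units_snd_inv_mul :
    ((h⁻¹).val.2.1).comp h.val.2.1 = .id ℝ E :=
  congrArg (fun a : ScalarEndEnd E V => a.2.1) h.inv_mul

theorem units_thd_inv_mul :
    ((h⁻¹).val.2.2).comp h.val.2.2 = .id ℝ V :=
  congrArg (fun a : ScalarEndEnd E V => a.2.2) h.inv_mul

end Units

theorem pull_units_mul (h k : (ScalarEndEnd E V)ˣ) (γ : Tensors r s V) :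
    Tensors.pull (h * k)⁻¹.val.2.2 (h * k).val.2.2 γ =
      Tensors.pull (h⁻¹).val.2.2 h.val.2.2 (Tensors.pull (k⁻¹).val.2.2 k.val.2.2 γ) := by
  rw [Tensors.pull_pull, mul_inv_rev]
  rfl

/-- Multiplication by the scalar and push-forward of tensors on `V`. -/
def scalarPush (r s : Fin m → ℕ) [FiniteDimensional ℝ V] :
    (ScalarEndEnd E V)ˣ →* (TensorSpace r s V →L[ℝ] TensorSpace r s V) where
  toFun h := LinearMap.toContinuousLinearMap
    (E := TensorSpace r s V) (F' := TensorSpace r s V)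
    (h.val.1 • Tensors.pullₗ r s (h⁻¹).val.2.2 h.val.2.2)
  map_one' := by
    refine ContinuousLinearMap.ext fun γ => ?_
    exact (one_smul ℝ (γ : TensorSpace r s V))
  map_mul' h k := by
    refine ContinuousLinearMap.ext fun γ => ?_
    refine (congrArg (fun x : TensorSpace r s V => (h.val.1 * k.val.1) • x)
      (pull_units_mul h k γ)).trans ?_
    refine (mul_smul (α := ℝ) (β := TensorSpace r s V) _ _ _).trans ?_
    exact congrArg (fun x : TensorSpace r s V => h.val.1 • x) (Tensors.pull_smul _ _ _ _).symm

theorem scalarPush_apply [FiniteDimensional ℝ V] (h : (ScalarEndEnd E V)ˣ) (γ : Tensors r s V) :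
    scalarPush r s h γ = (h.val.1 • (Tensors.pull (h⁻¹).val.2.2 h.val.2.2 γ : TensorSpace r s V) : TensorSpace r s V) := rfl

/-- The bracket `β` as a tensor of type `(2, 1)`. -/
abbrev BracketTensor (E : Type*) [NormedAddCommGroup E] [NormedSpace ℝ E] : Type _ :=
  Tensors (m := 1) (fun _ => 2) (fun _ => 1) E

/-- The pairs of a scalar and of an automorphism of `(E, β)` inducing a map on `V` through
`T : E → V`. -/
def bracketGroup (β : BracketTensor E) (T : E →L[ℝ] V) : Subgroup (ScalarEndEnd E V)ˣ where
  carrier := {h | Tensors.pull (h⁻¹).val.2.1 h.val.2.1 β = β ∧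
    h.val.2.2.comp T = T.comp h.val.2.1}
  one_mem' := ⟨Tensors.pull_id β, rfl⟩
  mul_mem' := by
    rintro h k ⟨h1, h2⟩ ⟨k1, k2⟩
    refine ⟨?_, ?_⟩
    · have : Tensors.pull (h * k)⁻¹.val.2.1 (h * k).val.2.1 β =
          Tensors.pull (h⁻¹).val.2.1 h.val.2.1 (Tensors.pull (k⁻¹).val.2.1 k.val.2.1 β) := by
        rw [Tensors.pull_pull, mul_inv_rev]
        rfl
      rw [this, k1, h1]
    · calc (h.val.2.2.comp k.val.2.2).comp T =
          h.val.2.2.comp (k.val.2.2.comp T) := rfl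
        _ = (h.val.2.2.comp T).comp k.val.2.1 := by rw [k2]; rfl
        _ = _ := by rw [h2]; rfl
  inv_mem' := by
    rintro h ⟨h1, h2⟩
    refine ⟨?_, ?_⟩
    · rw [inv_inv]
      nth_rewrite 1 [← h1]
      rw [Tensors.pull_pull, units_snd_inv_mul, Tensors.pull_id]
    · calc (h⁻¹).val.2.2.comp T =
          ((h⁻¹).val.2.2.comp T).comp (h.val.2.1.comp
            (h⁻¹).val.2.1) := by rw [units_snd_mul_inv]; rfl
        _ = (h⁻¹).val.2.2.comp ((T.comp h.val.2.1).comp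
            (h⁻¹).val.2.1) := rfl
        _ = ((h⁻¹).val.2.2.comp h.val.2.2).comp (T.comp
            (h⁻¹).val.2.1) := by rw [← h2]; rfl
        _ = _ := by rw [units_thd_inv_mul]; rfl

theorem mem_bracketGroup {β : BracketTensor E} {T : E →L[ℝ] V} {h : (ScalarEndEnd E V)ˣ} :
    h ∈ bracketGroup β T ↔
      Tensors.pull (h⁻¹).val.2.1 h.val.2.1 β = β ∧
      h.val.2.2.comp T = T.comp h.val.2.1 := Iff.rfl

/-- The scalars and derivations of `(E, β)` inducing a map on `V` through `T : E → V`. -/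
def bracketAlgebra (β : BracketTensor E) (T : E →L[ℝ] V) : Submodule ℝ (ScalarEndEnd E V) :=
  LinearMap.ker ((Tensors.thetaₗ _ _ E).flip β ∘ₗ LinearMap.fst ℝ _ _ ∘ₗ LinearMap.snd ℝ _ _) ⊓
    LinearMap.eqLocus
      (((ContinuousLinearMap.compL ℝ E V V).flip T : (V →L[ℝ] V) →ₗ[ℝ] (E →L[ℝ] V)) ∘ₗ LinearMap.snd ℝ _ _ ∘ₗ LinearMap.snd ℝ _ _)
      ((ContinuousLinearMap.compL ℝ E E V T : (E →L[ℝ] E) →ₗ[ℝ] (E →L[ℝ] V)) ∘ₗ LinearMap.fst ℝ _ _ ∘ₗ LinearMap.snd ℝ _ _)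

theorem mem_bracketAlgebra {β : BracketTensor E} {T : E →L[ℝ] V} {a : ScalarEndEnd E V} :
    a ∈ bracketAlgebra β T ↔ Tensors.theta a.2.1 β = 0 ∧ a.2.2.comp T = T.comp a.2.1 := Iff.rfl

theorem continuous_units_thd : Continuous fun h : (ScalarEndEnd E V)ˣ => h.val.2.2 :=
  continuous_snd.comp (continuous_snd.comp Units.continuous_val)

theorem continuous_units_snd : Continuous fun h : (ScalarEndEnd E V)ˣ => h.val.2.1 :=
  continuous_fst.comp (continuous_snd.comp Units.continuous_val)

theorem isClosed_bracketGroup (β : BracketTensor E) (T : E →L[ℝ] V) :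
    IsClosed (bracketGroup β T : Set (ScalarEndEnd E V)ˣ) := by
  refine IsClosed.inter ?_ ?_
  · refine isClosed_eq ?_ continuous_const
    have h1 : Continuous fun h : (ScalarEndEnd E V)ˣ => ((h⁻¹).val.2.1, h.val.2.1) :=
      (continuous_units_snd.comp continuous_inv).prodMk continuous_units_snd
    exact (Tensors.continuous_pull (W := E) (V := E) β).comp h1
  · exact isClosed_eq (continuous_units_thd.clm_comp continuous_const)
      (continuous_const.clm_comp continuous_units_snd)

variable [FiniteDimensional ℝ V]

theorem continuous_scalarPush :
    Continuous (scalarPush r s : (ScalarEndEnd E V)ˣ → TensorSpace r s V →L[ℝ] TensorSpace r s V) := by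
  refine continuous_clm_apply.2 fun γ => ?_
  have h1 : Continuous fun h : (ScalarEndEnd E V)ˣ => ((h⁻¹).val.2.2, h.val.2.2) :=
    (continuous_units_thd.comp continuous_inv).prodMk continuous_units_thd
  have h2 : Continuous fun h : (ScalarEndEnd E V)ˣ =>
      (Tensors.pull (h⁻¹).val.2.2 h.val.2.2 γ : TensorSpace r s V) :=
    (Tensors.continuous_pull (W := V) (V := V) γ).comp h1
  exact (continuous_fst.comp Units.continuous_val).smul h2

/-- The differential of `scalarPush`. -/
def scalarTheta (r s : Fin m → ℕ) :
    ScalarEndEnd E V →L[ℝ] TensorSpace r s V →L[ℝ] TensorSpace r s V :=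
  (ContinuousLinearMap.fst ℝ ℝ _).smulRight 1 +
    (thetaL r s V).comp ((ContinuousLinearMap.snd ℝ _ _).comp (ContinuousLinearMap.snd ℝ _ _))

theorem scalarTheta_eq (a : ScalarEndEnd E V) :
    scalarTheta r s a = a.1 • 1 + thetaL r s V a.2.2 := rfl

variable [FiniteDimensional ℝ E]

/-- Compatibility with `T` becomes the statement that an exponential fixes the vector `T`, the same
form as the invariance of the bracket. -/
theorem comp_exp_eq_iff (D : E →L[ℝ] E) (A : V →L[ℝ] V) (T : E →L[ℝ] V) :
    (NormedSpace.exp A).comp T = T.comp (NormedSpace.exp D) ↔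
      NormedSpace.exp (intertwine (D, A) : HomSpace E V →L[ℝ] HomSpace E V) T = T := by
  have : CompleteSpace E := FiniteDimensional.complete ℝ E
  rw [exp_intertwine_apply]
  have h1 : (NormedSpace.exp (-D)).comp (NormedSpace.exp D) = .id ℝ E := exp_neg_mul_exp D
  have h2 : (NormedSpace.exp D).comp (NormedSpace.exp (-D)) = .id ℝ E := by
    have := exp_neg_mul_exp (-D)
    rwa [neg_neg] at this
  constructor
  · intro h
    rw [← ContinuousLinearMap.comp_assoc, h, ContinuousLinearMap.comp_assoc, h2,
      ContinuousLinearMap.comp_id]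
  · intro h
    nth_rewrite 2 [← h]
    rw [ContinuousLinearMap.comp_assoc, ContinuousLinearMap.comp_assoc, h1,
      ContinuousLinearMap.comp_id]

theorem scalarPush_exp (u : (ScalarEndEnd E V)ˣ) (a : ScalarEndEnd E V)
    (h : (u : ScalarEndEnd E V) = NormedSpace.exp a) :
    scalarPush r s u = NormedSpace.exp (scalarTheta r s a) := by
  have : CompleteSpace E := FiniteDimensional.complete ℝ E
  have : CompleteSpace V := FiniteDimensional.complete ℝ V
  have : CompleteSpace (TensorSpace r s V) := FiniteDimensional.complete ℝ _
  have h' := val_inv_eq_exp_neg h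
  rw [exp_scalarEndEnd] at h h'
  refine ContinuousLinearMap.ext fun γ => ?_
  refine (scalarPush_apply u γ).trans ?_
  rw [scalarTheta_eq, exp_smul_one_add, h, h']
  exact congrArg (fun x : TensorSpace r s V => NormedSpace.exp a.1 • x) (pull_exp a.2.2 γ)

theorem mem_bracketGroup_iff_of_exp {β : BracketTensor E} {T : E →L[ℝ] V}
    {u : (ScalarEndEnd E V)ˣ} {a : ScalarEndEnd E V}
    (h : (u : ScalarEndEnd E V) = NormedSpace.exp a) :
    u ∈ bracketGroup β T ↔ NormedSpace.exp (thetaL (fun _ => 2) (fun _ => 1) E a.2.1) β = β ∧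
      NormedSpace.exp (intertwine (a.2.1, a.2.2) : HomSpace E V →L[ℝ] HomSpace E V) T = T := by
  have : CompleteSpace E := FiniteDimensional.complete ℝ E
  have : CompleteSpace V := FiniteDimensional.complete ℝ V
  have h' := val_inv_eq_exp_neg h
  rw [exp_scalarEndEnd] at h h'
  rw [mem_bracketGroup, h, h', ← comp_exp_eq_iff]
  exact and_congr_left fun _ => by rw [← pull_exp]; rfl

theorem mem_bracketGroup_of_exp {β : BracketTensor E} {T : E →L[ℝ] V} {a : ScalarEndEnd E V}
    (ha : a ∈ bracketAlgebra β T) (u : (ScalarEndEnd E V)ˣ)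
    (h : (u : ScalarEndEnd E V) = NormedSpace.exp a) : u ∈ bracketGroup β T := by
  have : CompleteSpace (TensorSpace (m := 1) (fun _ => 2) (fun _ => 1) E) :=
    FiniteDimensional.complete ℝ _
  have : CompleteSpace (HomSpace E V) := FiniteDimensional.complete ℝ _
  rw [mem_bracketAlgebra] at ha
  rw [mem_bracketGroup_iff_of_exp h]
  refine ⟨exp_apply_of_apply_eq_zero ha.1, exp_apply_of_apply_eq_zero ?_⟩
  exact (intertwine_apply a.2.1 a.2.2 T).trans (sub_eq_zero.2 ha.2)

/-- Both conditions defining the group say that an exponential fixes a vector. For a small generator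
this forces the generator to annihilate the vector; for a large one it need not, as a full rotation
shows. -/
theorem eventually_mem_bracketAlgebra (β : BracketTensor E) (T : E →L[ℝ] V) :
    ∀ᶠ a in 𝓝 (0 : ScalarEndEnd E V), ∀ u ∈ bracketGroup β T,
      (u : ScalarEndEnd E V) = NormedSpace.exp a → a ∈ bracketAlgebra β T := by
  have : CompleteSpace (TensorSpace (m := 1) (fun _ => 2) (fun _ => 1) E) :=
    FiniteDimensional.complete ℝ _
  have : CompleteSpace (HomSpace E V) := FiniteDimensional.complete ℝ _
  obtain ⟨δ, hδ, h1⟩ := exists_forall_apply_eq_zero_of_exp_apply_eq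
    (W := TensorSpace (m := 1) (fun _ => 2) (fun _ => 1) E)
  obtain ⟨ε, hε, h2⟩ := exists_forall_apply_eq_zero_of_exp_apply_eq (W := HomSpace E V)
  have c1 : Continuous fun a : ScalarEndEnd E V => ‖thetaL (m := 1) (fun _ => 2) (fun _ => 1) E a.2.1‖ :=
    ((thetaL _ _ E).continuous.comp (continuous_fst.comp continuous_snd)).norm
  have c2 : Continuous fun a : ScalarEndEnd E V =>
      ‖(intertwine (a.2.1, a.2.2) : HomSpace E V →L[ℝ] HomSpace E V)‖ :=
    (intertwine.continuous.comp continuous_snd).norm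
  have e1 := (c1.tendsto 0).eventually_lt_const (u := δ) (by
    change ‖thetaL (m := 1) (fun _ => 2) (fun _ => 1) E 0‖ < δ
    rwa [map_zero, norm_zero])
  have e2 := (c2.tendsto 0).eventually_lt_const (u := ε) (by
    change ‖(intertwine (0 : (E →L[ℝ] E) × (V →L[ℝ] V)) : HomSpace E V →L[ℝ] HomSpace E V)‖ < ε
    rwa [map_zero, norm_zero])
  filter_upwards [e1, e2] with a ha1 ha2 u hu hua
  rw [mem_bracketGroup_iff_of_exp hua] at hu
  exact ⟨h1 _ ha1 β hu.1, sub_eq_zero.1 (h2 _ ha2 T hu.2)⟩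

/-- The action of `bracketGroup β T` on tensors on `V`. -/
def bracketAction (r s : Fin m → ℕ) (β : BracketTensor E) (T : E →L[ℝ] V) :
    LinearAction (ScalarEndEnd E V) (TensorSpace r s V) where
  rep := scalarPush r s
  drep := scalarTheta r s
  grp := bracketGroup β T
  alg := bracketAlgebra β T
  continuous_rep := continuous_scalarPush
  rep_exp := scalarPush_exp
  isClosed_grp := isClosed_bracketGroup β T
  exp_mem _ ha u hu := mem_bracketGroup_of_exp ha u hu
  mem_of_exp_mem := eventually_mem_bracketAlgebra β T

/-- A continuously differentiable curve of tensors on `V` obtained from one of them through scalars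
and automorphisms of `(E, β)` is tangent to the direction given by a scalar and a derivation. -/
theorem exists_derivation_of_orbit (β : BracketTensor E) (T : E →L[ℝ] V)
    {x x' : ℝ → Tensors r s V} {J : Set ℝ} (hJ : IsOpen J) (h0 : (0 : ℝ) ∈ J)
    (hx : ∀ t ∈ J, HasDerivAt x (x' t) t) (hx' : ContinuousAt x' 0)
    (horb : ∀ t ∈ J, ∃ (c : ℝ) (φ φ' : E →L[ℝ] E) (L L' : V →L[ℝ] V), c ≠ 0 ∧
      φ.comp φ' = .id ℝ E ∧ φ'.comp φ = .id ℝ E ∧ L.comp L' = .id ℝ V ∧ L'.comp L = .id ℝ V ∧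
      Tensors.pull φ φ' β = β ∧ L.comp T = T.comp φ ∧ x t = c • Tensors.pull L L' (x 0)) :
    ∃ (c : ℝ) (D : E →L[ℝ] E) (A : V →L[ℝ] V), Tensors.theta D β = 0 ∧ A.comp T = T.comp D ∧
      x' 0 = c • x 0 + Tensors.theta A (x 0) := by
  have key := (bracketAction r s β T).deriv_mem_orbitTangent (W := TensorSpace r s V)
    (x := x) (x' := x') hJ h0 hx hx' ?_
  · obtain ⟨a, ha, hax⟩ := key
    exact ⟨a.1, a.2.1, a.2.2, ha.1, ha.2, hax.symm⟩
  · intro t ht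
    obtain ⟨c, φ, φ', L, L', hc, h1, h2, h3, h4, h5, h6, h7⟩ := horb t ht
    let u : (ScalarEndEnd E V)ˣ := ⟨(c⁻¹, φ, L), (c, φ', L'),
      Prod.ext (inv_mul_cancel₀ hc) (Prod.ext h1 h3), Prod.ext (mul_inv_cancel₀ hc) (Prod.ext h2 h4)⟩
    -- The representation pushes tensors forward, whereas the curve is given by pull-backs. This is
    -- why the inverse appears, and why `u` has scalar part `c⁻¹`.
    refine ⟨u⁻¹, (bracketGroup β T).inv_mem' ?_, ?_⟩
    · refine ⟨?_, h6⟩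
      change Tensors.pull φ' φ β = β
      nth_rewrite 1 [← h5]
      rw [Tensors.pull_pull, h1, Tensors.pull_id]
    · exact h7

end HomogeneousAction

/-! ### Ordinary differential equations on embedded submanifolds -/

section EmbeddedODE

theorem deriv_mem_of_eventually_mem {W : Type*} [NormedAddCommGroup W] [NormedSpace ℝ W]
    {F : Submodule ℝ W} (hF : IsClosed (F : Set W)) {g : ℝ → W} {g' : W} {t : ℝ}
    (hg : HasDerivAt g g' t) (h : ∀ᶠ u in 𝓝 t, g u ∈ F) : g' ∈ F := by
  refine hF.mem_of_tendsto (hasDerivAt_iff_tendsto_slope.1 hg) ?_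
  filter_upwards [h.filter_mono nhdsWithin_le_nhds] with u hu
  exact F.smul_mem _ (F.sub_mem hu h.self_of_nhds)

variable {W : Type*} [NormedAddCommGroup W] [NormedSpace ℝ W] [FiniteDimensional ℝ W]
  {S : Set W} {Q : W → W}

/-- A tangent vector field on an embedded submanifold in a chart. -/
theorem exists_chart_vectorField (hS : IsEmbeddedSubmanifold S) (hQ : ContDiffOn ℝ ∞ Q S)
    (hT : ∀ w ∈ S, Q w ∈ tangentVectors S w) {w : W} (hw : w ∈ S) :
    ∃ (F : Submodule ℝ W) (ψ : W → F) (Ψ : F → W) (Z : F → F), ContDiffAt ℝ 1 Z (ψ w) ∧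
      (∀ᶠ x in 𝓝 w, x ∈ S → Ψ (ψ x) = x ∧ ∀ (c : ℝ → W) (t : ℝ), c t = x →
        HasDerivAt c (Q x) t → HasDerivAt (fun u => ψ (c u)) (Z (ψ x)) t) ∧
      (∀ᶠ z in 𝓝 (ψ w), Ψ z ∈ S ∧ ∀ (c : ℝ → F) (t : ℝ), c t = z →
        HasDerivAt c (Z z) t → HasDerivAt (fun u => Ψ (c u)) (Q (Ψ z)) t) := by
  obtain ⟨Φ, F, hwΦ, hΦ, hΦs, hSF⟩ := hS w hw
  obtain ⟨P, hP⟩ : ∃ P : W →L[ℝ] F, ∀ x : F, P x = x :=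
    Submodule.ClosedComplemented.of_finiteDimensional F
  have hd : ∀ x ∈ Φ.source, HasFDerivAt Φ (fderiv ℝ Φ x) x := fun x hx =>
    ((hΦ.differentiableOn (by simp)).differentiableAt (Φ.open_source.mem_nhds hx)).hasFDerivAt
  have hds : ∀ z ∈ Φ.target, HasFDerivAt Φ.symm (fderiv ℝ Φ.symm z) z := fun z hz =>
    ((hΦs.differentiableOn (by simp)).differentiableAt (Φ.open_target.mem_nhds hz)).hasFDerivAt
  have hinv : ∀ x ∈ Φ.source, ∀ v, fderiv ℝ Φ.symm (Φ x) (fderiv ℝ Φ x v) = v := by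
    intro x hx v
    have h1 := (hds (Φ x) (Φ.map_source hx)).comp x (hd x hx)
    have h2 : HasFDerivAt (Φ.symm ∘ Φ) (ContinuousLinearMap.id ℝ W) x :=
      (hasFDerivAt_id x).congr_of_eventuallyEq
        (Filter.eventuallyEq_of_mem (Φ.open_source.mem_nhds hx) fun y hy => Φ.left_inv hy)
    exact DFunLike.congr_fun (h1.unique h2) v
  -- `Q x` is the velocity of a curve in `S`, which the chart carries into the closed subspace `F`.
  have htan : ∀ x ∈ Φ.source, x ∈ S → fderiv ℝ Φ x (Q x) ∈ F := by
    intro x hx hxS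
    obtain ⟨σ, hσ0, hσS, hσ⟩ := hT x hxS
    subst hσ0
    refine deriv_mem_of_eventually_mem F.closed_of_finiteDimensional
      ((hd _ hx).comp_hasDerivAt 0 hσ) ?_
    filter_upwards [hσS, hσ.continuousAt.eventually (Φ.open_source.mem_nhds hx)] with t h1 h2
    exact (hSF _ h2).1 h1
  have hψ : ∀ x ∈ Φ.source, x ∈ S → (P (Φ x) : W) = Φ x := fun x hx hxS =>
    congrArg Subtype.val (hP ⟨Φ x, (hSF x hx).1 hxS⟩)
  have hΨS : ∀ z : F, (z : W) ∈ Φ.target → Φ.symm z ∈ S := fun z hz => by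
    rw [hSF _ (Φ.map_target hz), Φ.right_inv hz]
    exact z.2
  let U : Set F := (fun z : F => (z : W)) ⁻¹' Φ.target
  have hU : IsOpen U := Φ.open_target.preimage continuous_subtype_val
  have hwU : P (Φ w) ∈ U := by
    change (P (Φ w) : W) ∈ Φ.target
    rw [hψ w hwΦ hw]
    exact Φ.map_source hwΦ
  refine ⟨F, fun x => P (Φ x), fun z => Φ.symm z,
    fun z => P (fderiv ℝ Φ (Φ.symm z) (Q (Φ.symm z))), ?_, ?_, ?_⟩
  · have h1 : ContDiffOn ℝ ∞ (fun z : F => Φ.symm z) U :=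
      hΦs.comp (F.subtypeL.contDiff.contDiffOn) fun z hz => hz
    have h2 : ContDiffOn ℝ ∞ (fun z : F => Q (Φ.symm z)) U := hQ.comp h1 fun z hz => hΨS z hz
    have h3 : ContDiffOn ℝ ∞ (fun z : F => fderiv ℝ Φ (Φ.symm z)) U :=
      (hΦ.fderiv_of_isOpen (m := ∞) Φ.open_source (by simp)).comp h1 fun z hz => Φ.map_target hz
    exact ((P.contDiff.comp_contDiffOn (h3.clm_apply h2)).contDiffAt (hU.mem_nhds hwU)).of_le
      (by exact_mod_cast le_top)
  · filter_upwards [Φ.open_source.mem_nhds hwΦ] with x hx hxS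
    have hl : Φ.symm (P (Φ x) : W) = x := by rw [hψ x hx hxS, Φ.left_inv hx]
    refine ⟨hl, fun c t hc hct => ?_⟩
    rw [hl]
    subst hc
    exact P.hasFDerivAt.comp_hasDerivAt t ((hd _ hx).comp_hasDerivAt t hct)
  · filter_upwards [hU.mem_nhds hwU] with z hz
    refine ⟨hΨS z hz, fun c t hc hct => ?_⟩
    subst hc
    have h1 : HasDerivAt (fun u => (c u : W)) _ t := F.subtypeL.hasFDerivAt.comp_hasDerivAt t hct
    have h2 := (hds _ hz).comp_hasDerivAt t h1
    refine h2.congr_deriv ?_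
    have h3 := htan _ (Φ.map_target hz) (hΨS _ hz)
    have h4 := congrArg Subtype.val (hP ⟨_, h3⟩)
    have h5 := hinv _ (Φ.map_target hz) (Q (Φ.symm (c t)))
    rw [Φ.right_inv hz] at h5
    rw [Submodule.subtypeL_apply, h4, h5]

/-- `Q` is smooth only along `S`, so the Picard–Lindelöf theorem is applied to the chart expression
`Z` on the subspace `F`. The solution is then carried back to `S`. -/
theorem exists_solution_of_isEmbeddedSubmanifold (hS : IsEmbeddedSubmanifold S)
    (hQ : ContDiffOn ℝ ∞ Q S) (hT : ∀ w ∈ S, Q w ∈ tangentVectors S w) {w : W} (hw : w ∈ S)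
    (t₀ : ℝ) :
    ∃ y : ℝ → W, y t₀ = w ∧ ∀ᶠ t in 𝓝 t₀, y t ∈ S ∧ HasDerivAt y (Q (y t)) t := by
  obtain ⟨F, ψ, Ψ, Z, hZ, h1, h2⟩ := exists_chart_vectorField hS hQ hT hw
  obtain ⟨z, hz0, ε, hε, hz⟩ := hZ.exists_forall_mem_closedBall_exists_eq_forall_mem_Ioo_hasDerivAt₀ t₀
  have hnb : Set.Ioo (t₀ - ε) (t₀ + ε) ∈ 𝓝 t₀ := Ioo_mem_nhds (by linarith) (by linarith)
  refine ⟨fun t => Ψ (z t), (congrArg Ψ hz0).trans (h1.self_of_nhds hw).1, ?_⟩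
  have hc : Filter.Tendsto z (𝓝 t₀) (𝓝 (ψ w)) := by
    rw [← hz0]
    exact (hz t₀ (mem_of_mem_nhds hnb)).continuousAt
  filter_upwards [hnb, hc.eventually h2] with t ht h3
  exact ⟨h3.1, h3.2 z t rfl (hz t ht)⟩

/-- Both curves are read in one chart, where `Z` is Lipschitz near their common value. -/
theorem solution_unique_of_isEmbeddedSubmanifold (hS : IsEmbeddedSubmanifold S)
    (hQ : ContDiffOn ℝ ∞ Q S) (hT : ∀ w ∈ S, Q w ∈ tangentVectors S w) {t₀ : ℝ} {x y : ℝ → W}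
    (hx : ∀ᶠ t in 𝓝 t₀, x t ∈ S ∧ HasDerivAt x (Q (x t)) t)
    (hy : ∀ᶠ t in 𝓝 t₀, y t ∈ S ∧ HasDerivAt y (Q (y t)) t) (hxy : x t₀ = y t₀) :
    x =ᶠ[𝓝 t₀] y := by
  obtain ⟨F, ψ, Ψ, Z, hZ, h1, -⟩ := exists_chart_vectorField hS hQ hT hx.self_of_nhds.1
  obtain ⟨K, s, hs, hK⟩ := hZ.exists_lipschitzOnWith
  have key : ∀ c : ℝ → W, (∀ᶠ t in 𝓝 t₀, c t ∈ S ∧ HasDerivAt c (Q (c t)) t) → c t₀ = x t₀ →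
      ∀ᶠ t in 𝓝 t₀, (HasDerivAt (fun u => ψ (c u)) (Z (ψ (c t))) t ∧ ψ (c t) ∈ s) ∧
        Ψ (ψ (c t)) = c t := by
    intro c hc hc0
    have h2 : Filter.Tendsto c (𝓝 t₀) (𝓝 (x t₀)) := hc0 ▸ hc.self_of_nhds.2.continuousAt
    have h3 : ∀ᶠ t in 𝓝 t₀, HasDerivAt (fun u => ψ (c u)) (Z (ψ (c t))) t ∧ Ψ (ψ (c t)) = c t := by
      filter_upwards [h2.eventually h1, hc] with t h4 h5
      exact ⟨(h4 h5.1).2 c t rfl h5.2, (h4 h5.1).1⟩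
    have h6 : ContinuousAt (fun u => ψ (c u)) t₀ := h3.self_of_nhds.1.continuousAt
    have h7 : ∀ᶠ t in 𝓝 t₀, ψ (c t) ∈ s := h6.eventually_mem (by simpa only [hc0] using hs)
    filter_upwards [h3, h7] with t h8 h9
    exact ⟨⟨h8.1, h9⟩, h8.2⟩
  have kx := key x hx rfl
  have ky := key y hy hxy.symm
  have h := ODE_solution_unique_of_eventually (v := fun _ => Z) (s := fun _ => s) (K := K)
    (Filter.Eventually.of_forall fun _ => hK) (kx.mono fun _ h => h.1) (ky.mono fun _ h => h.1)
    (by rw [hxy])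
  filter_upwards [h, kx, ky] with t ht h1 h2
  rw [← h1.2, ← h2.2, ht]

end EmbeddedODE

/-! ### Pull-backs of tensor fields and invariance -/

section Pullback

variable {n m : ℕ} {r s : Fin m → ℕ}
  {M : Type*} [TopologicalSpace M] [ChartedSpace (EuclideanSpace ℝ (Fin n)) M]

theorem differential_comp {n₁ n₂ n₃ : ℕ}
    {M₁ : Type*} [TopologicalSpace M₁] [ChartedSpace (EuclideanSpace ℝ (Fin n₁)) M₁]
    {M₂ : Type*} [TopologicalSpace M₂] [ChartedSpace (EuclideanSpace ℝ (Fin n₂)) M₂]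
    {M₃ : Type*} [TopologicalSpace M₃] [ChartedSpace (EuclideanSpace ℝ (Fin n₃)) M₃]
    {g : M₂ → M₃} {f : M₁ → M₂} (x : M₁) (hg : MDifferentiableAt (𝓡 n₂) (𝓡 n₃) g (f x))
    (hf : MDifferentiableAt (𝓡 n₁) (𝓡 n₂) f x) :
    differential (n := n₁) (n' := n₃) (g ∘ f) x =
      (differential (n := n₂) (n' := n₃) g (f x)).comp (differential (n := n₁) (n' := n₂) f x) :=
  mfderiv_comp x hg hf

theorem differential_id (x : M) : differential (n := n) (n' := n) (id : M → M) x = .id ℝ _ :=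
  mfderiv_id

theorem Diff.mdifferentiableAt (f : Diff n M) (x : M) : MDifferentiableAt (𝓡 n) (𝓡 n) f x :=
  f.mdifferentiable (by simp) x

theorem differential_symm_comp (f : Diff n M) (x : M) :
    (differential (n := n) (n' := n) f.symm (f x)).comp (differential (n := n) (n' := n) f x) =
      .id ℝ _ := by
  rw [← differential_comp x (Diff.mdifferentiableAt f.symm (f x)) (Diff.mdifferentiableAt f x)]
  have : (f.symm ∘ f : M → M) = id := funext f.symm_apply_apply
  rw [this, differential_id]

theorem differential_comp_symm (f : Diff n M) (x : M) :
    (differential (n := n) (n' := n) f x).comp (differential (n := n) (n' := n) f.symm (f x)) =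
      .id ℝ _ := by
  have := differential_symm_comp f.symm (f x)
  rwa [f.symm_apply_apply] at this

theorem pullback_trans (f g : Diff n M) (γ : TensorField r s n M) :
    pullback (f.trans g) γ = pullback f (pullback g γ) := by
  funext x
  have h1 : differential (n := n) (n' := n) (f.trans g) x =
      (differential (n := n) (n' := n) g (f x)).comp (differential (n := n) (n' := n) f x) :=
    differential_comp x (Diff.mdifferentiableAt g (f x)) (Diff.mdifferentiableAt f x)
  have h2 : differential (n := n) (n' := n) (f.trans g).symm (g (f x)) =
      (differential (n := n) (n' := n) f.symm (f x)).comp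
        (differential (n := n) (n' := n) g.symm (g (f x))) := by
    have h3 := differential_comp (n₁ := n) (n₂ := n) (n₃ := n) (g := f.symm) (f := g.symm) (g (f x))
      (Diff.mdifferentiableAt f.symm _) (Diff.mdifferentiableAt g.symm (g (f x)))
    rw [g.symm_apply_apply] at h3
    exact h3
  change Tensors.pull (differential (n := n) (n' := n) (f.trans g) x)
    (differential (n := n) (n' := n) (f.trans g).symm (g (f x)))
    (γ (g (f x))) = _
  rw [h1, h2]
  rfl

theorem pullback_refl (γ : TensorField r s n M) : pullback (Diffeomorph.refl _ _ _) γ = γ := by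
  funext x
  have h : differential (n := n) (n' := n) (Diffeomorph.refl (𝓡 n) M ∞) x = .id ℝ _ :=
    differential_id x
  change Tensors.pull (differential (n := n) (n' := n) (Diffeomorph.refl (𝓡 n) M ∞) x)
    (differential (n := n) (n' := n) (Diffeomorph.refl (𝓡 n) M ∞) x) (γ x) = γ x
  rw [h, Tensors.pull_id]

theorem pullback_smul (f : Diff n M) (c : ℝ) (γ : TensorField r s n M) :
    pullback f (c • γ) = c • pullback f γ :=
  funext fun _ => Tensors.pull_smul _ _ _ _

theorem pullback_symm_pullback (f : Diff n M) (γ : TensorField r s n M) :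
    pullback f.symm (pullback f γ) = γ := by
  rw [← pullback_trans, Diffeomorph.symm_trans_self, pullback_refl]

theorem pullback_pullback_symm (f : Diff n M) (γ : TensorField r s n M) :
    pullback f (pullback f.symm γ) = γ := by
  rw [← pullback_trans, Diffeomorph.self_trans_symm, pullback_refl]

/-- A tensor field invariant under a diffeomorphism taking `o` to `x` is determined at `x` by
its value at `o`. -/
theorem eq_of_pullback_eq {γ γ' : TensorField r s n M} {f : Diff n M} {o : M}
    (h : pullback f γ = γ) (h' : pullback f γ' = γ') (ho : γ o = γ' o) : γ (f o) = γ' (f o) := by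
  have key : ∀ {γ : TensorField r s n M}, pullback f γ = γ → γ (f o) =
      Tensors.pull (differential f.symm (f o)) (differential f o) (γ o) := by
    intro γ h
    nth_rewrite 2 [← h]
    rw [pullback, Tensors.pull_pull, differential_comp_symm, Tensors.pull_id]
  rw [key h, key h', ho]

section Action

variable {G : Type*} [Group G] [MulAction G M]

theorem IsAutomorphismGroup.isInvariant {γ : TensorField r s n M} (hG : IsAutomorphismGroup G γ) :
    IsInvariant G γ := fun a f hf => (hG.mem_iff f).2 ⟨a, hf⟩

theorem IsAutomorphismGroup.exists_smul_eq {γ : TensorField r s n M} (hG : IsAutomorphismGroup G γ)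
    (hhom : IsHomogeneous γ) (x y : M) : ∃ a : G, a • x = y := by
  obtain ⟨f, hf, hxy⟩ := hhom x y
  obtain ⟨a, ha⟩ := (hG.mem_iff f).1 hf
  exact ⟨a, (ha x).symm.trans hxy⟩

variable (k : ℕ) [TopologicalSpace G] [ChartedSpace (EuclideanSpace ℝ (Fin k)) G]
  [ContMDiffSMul (𝓡 k) (𝓡 n) ∞ G M]

/-- The diffeomorphism given by an element of the group. -/
def actionDiffeo (a : G) : Diff n M := Diffeomorph.smul (𝓡 k) (𝓡 n) ∞ a

@[simp] theorem actionDiffeo_apply (a : G) (x : M) :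
    actionDiffeo (n := n) k a x = a • x := rfl

theorem isInvariant_iff {γ : TensorField r s n M} :
    IsInvariant G γ ↔ ∀ a : G, pullback (actionDiffeo k a) γ = γ := by
  refine ⟨fun h a => h a _ fun _ => rfl, fun h a f hf => ?_⟩
  rw [show f = actionDiffeo k a from Diffeomorph.ext hf]
  exact h a

end Action

theorem eq_of_isInvariant (k : ℕ) {G : Type*} [Group G] [MulAction G M] [TopologicalSpace G]
    [ChartedSpace (EuclideanSpace ℝ (Fin k)) G] [ContMDiffSMul (𝓡 k) (𝓡 n) ∞ G M]
    {γ γ' : TensorField r s n M} {o : M} (ho : ∀ x : M, ∃ a : G, a • o = x)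
    (h : IsInvariant G γ) (h' : IsInvariant G γ') (hoo : γ o = γ' o) : γ = γ' := by
  funext x
  obtain ⟨a, rfl⟩ := ho x
  exact eq_of_pullback_eq ((isInvariant_iff k).1 h a) ((isInvariant_iff k).1 h' a) hoo

end Pullback

/-! ### Diffeomorphisms normalizing the group -/

/-- Effectiveness makes the element `b` attached to `a` unique. Hence the two assignments are
mutually inverse and the first is multiplicative. -/
theorem exists_mulEquiv_of_normalizes {G M : Type*} [Group G] [MulAction G M]
    (heff : ∀ a b : G, (∀ x : M, a • x = b • x) → a = b) (f : M ≃ M)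
    (h : ∀ a : G, ∃ b : G, ∀ x, f (a • x) = b • f x)
    (h' : ∀ a : G, ∃ b : G, ∀ x, f.symm (a • x) = b • f.symm x) :
    ∃ φ : G ≃* G, ∀ a x, f (a • x) = φ a • f x := by
  choose φ hφ using h
  choose ψ hψ using h'
  refine ⟨⟨⟨φ, ψ, fun a => heff _ _ fun x => ?_, fun a => heff _ _ fun x => ?_⟩,
    fun a b => heff _ _ fun x => ?_⟩, hφ⟩
  · have h1 := hψ (φ a) (f x)
    rw [← hφ, f.symm_apply_apply, f.symm_apply_apply] at h1
    exact h1.symm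
  · have h1 := hφ (ψ a) (f.symm x)
    rw [← hψ, f.apply_symm_apply, f.apply_symm_apply] at h1
    exact h1.symm
  · obtain ⟨y, rfl⟩ := f.surjective x
    change φ (a * b) • f y = (φ a * φ b) • f y
    rw [← hφ, mul_smul, mul_smul, hφ, hφ]

/-! ### Self-similarity forces the diffeomorphisms to normalize the group -/

section Normalize

variable {n m : ℕ} {r s : Fin m → ℕ}
  {M : Type*} [TopologicalSpace M] [ChartedSpace (EuclideanSpace ℝ (Fin n)) M]
  {G : Type*} [Group G] [MulAction G M]

theorem Tensors.hasDerivAt_pull {V W : Type*} [NormedAddCommGroup V] [NormedSpace ℝ V]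
    [NormedAddCommGroup W] [NormedSpace ℝ W] [FiniteDimensional ℝ W] (L : V →L[ℝ] W)
    (L' : W →L[ℝ] V) {x : ℝ → Tensors r s W} {x' : Tensors r s W} {t : ℝ}
    (hx : HasDerivAt x x' t) :
    HasDerivAt (fun u => Tensors.pull L L' (x u)) (Tensors.pull L L' x') t :=
  (Tensors.pullₗ r s L L').toContinuousLinearMap.hasFDerivAt.comp_hasDerivAt t hx

/-- Since `a` preserves `f^*γ`, the conjugate `f a f⁻¹` preserves `γ`, and `G` contains all such
diffeomorphisms. -/
theorem exists_smul_apply_of_pullback_eq (k : ℕ) [TopologicalSpace G]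
    [ChartedSpace (EuclideanSpace ℝ (Fin k)) G] [ContMDiffSMul (𝓡 k) (𝓡 n) ∞ G M]
    {γ : TensorField r s n M} (hG : IsAutomorphismGroup G γ)
    {f : Diff n M} (h : IsInvariant G (pullback f γ)) (a : G) :
    ∃ b : G, ∀ x, f (a • x) = b • f x := by
  have h1 : pullback (f.symm.trans ((actionDiffeo k a).trans f)) γ = γ := by
    rw [pullback_trans, pullback_trans, (isInvariant_iff k).1 h a, pullback_symm_pullback]
  obtain ⟨b, hb⟩ := (hG.mem_iff _).1 h1
  refine ⟨b, fun x => ?_⟩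
  rw [← hb (f x)]
  simp [Diffeomorph.coe_trans]

theorem isInvariant_pullback (k : ℕ) [TopologicalSpace G]
    [ChartedSpace (EuclideanSpace ℝ (Fin k)) G] [ContMDiffSMul (𝓡 k) (𝓡 n) ∞ G M]
    {γ : TensorField r s n M} (h : IsInvariant G γ)
    {f : Diff n M} (hf : ∀ a : G, ∃ b : G, ∀ x, f (a • x) = b • f x) :
    IsInvariant G (pullback f γ) := by
  refine (isInvariant_iff k).2 fun a => ?_
  obtain ⟨b, hb⟩ := hf a
  have h1 : (actionDiffeo k a).trans f = f.trans (actionDiffeo k b) := Diffeomorph.ext hb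
  rw [← pullback_trans, h1, pullback_trans, (isInvariant_iff k).1 h b]

variable {Γ : Set (TensorField r s n M)} {q : TensorField r s n M → TensorField r s n M}
  {J : Set ℝ} {γt : ℝ → TensorField r s n M} {o : M}

/-- Only `f G f⁻¹ ⊂ G` is available, so `f^*` preserves invariance but `(f⁻¹)^*` might not. Hence
the flow is solved among invariant values starting from `(f⁻¹)^*γ(t)`, and the solution is pulled
back by `f`. By uniqueness this gives `γ(u)`, so `(f⁻¹)^*γ(u)` is the invariant structure just
found. -/
theorem eventually_isInvariant_pullback_symm (k : ℕ) [TopologicalSpace G]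
    [ChartedSpace (EuclideanSpace ℝ (Fin k)) G] [ContMDiffSMul (𝓡 k) (𝓡 n) ∞ G M]
    (hq : IsPreferredDirection Γ q)
    (ho : ∀ x : M, ∃ a : G, a • o = x) (hreg : IsSmoothOnInvariants G o Γ q)
    (hJ : IsOpen J) (hflow : IsFlowSolution Γ q J γt) (hinv : ∀ t ∈ J, IsInvariant G (γt t))
    {f : Diff n M} (hfo : f o = o) (hf : ∀ a : G, ∃ b : G, ∀ x, f (a • x) = b • f x)
    {t : ℝ} (ht : t ∈ J) (h : IsInvariant G (pullback f.symm (γt t))) :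
    ∀ᶠ u in 𝓝 t, IsInvariant G (pullback f.symm (γt u)) := by
  obtain ⟨hS, Q, hQ, hT, hQq⟩ := hreg
  obtain ⟨y, hyt, hy⟩ := exists_solution_of_isEmbeddedSubmanifold hS hQ hT
    (w := pullback f.symm (γt t) o) ⟨_, hq.pullback_mem f.symm _ (hflow t ht).1, h, rfl⟩ t
  let P : Tensors r s (EuclideanSpace ℝ (Fin n)) → Tensors r s (EuclideanSpace ℝ (Fin n)) :=
    Tensors.pull (differential (n := n) (n' := n) f o)
      (differential (n := n) (n' := n) f.symm (f o))
  have hP : ∀ γ : TensorField r s n M, pullback f γ o = P (γ o) := by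
    intro γ
    change P (γ (f o)) = _
    rw [hfo]
  -- As `f` fixes `o`, pull-back by `f` acts on values at `o` by the fixed linear map `P`.
  -- Equivariance of `q` makes `P` commute with the vector field `Q`, so `P` maps solutions to
  -- solutions.
  have key : ∀ w ∈ invariantValues G o Γ, P w ∈ invariantValues G o Γ ∧ Q (P w) = P (Q w) := by
    rintro _ ⟨γ', hγ', hi, rfl⟩
    have hi' : IsInvariant G (pullback f γ') := isInvariant_pullback k hi hf
    refine ⟨⟨_, hq.pullback_mem f _ hγ', hi', hP γ'⟩, ?_⟩
    rw [← hP, ← hQq _ (hq.pullback_mem f _ hγ') hi', hq.equivariant f _ hγ', hP, hQq _ hγ' hi]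
  have hPd : ∀ (c : ℝ → Tensors r s (EuclideanSpace ℝ (Fin n))) (c') (u : ℝ), HasDerivAt c c' u →
      HasDerivAt (fun u => P (c u)) (P c') u := by
    exact fun c c' u hc => Tensors.hasDerivAt_pull _ _ hc
  have h1 := solution_unique_of_isEmbeddedSubmanifold hS hQ hT (t₀ := t) (x := fun u => γt u o)
    (y := fun u => P (y u))
    (by
      filter_upwards [hJ.mem_nhds ht] with u hu
      refine ⟨⟨_, (hflow u hu).1, hinv u hu, rfl⟩, ?_⟩
      rw [← hQq _ (hflow u hu).1 (hinv u hu)]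
      exact (hflow u hu).2 o)
    (by
      filter_upwards [hy] with u hu
      refine ⟨(key _ hu.1).1, ?_⟩
      rw [(key _ hu.1).2]
      exact hPd _ _ _ hu.2)
    (by
      rw [hyt, ← hP, pullback_pullback_symm])
  filter_upwards [h1, hy, hJ.mem_nhds ht] with u hu hyu huJ
  obtain ⟨γ', hγ', hi, hγo⟩ := hyu.1
  have h2 : γt u = pullback f γ' := by
    refine eq_of_isInvariant k ho (hinv u huJ) (isInvariant_pullback k hi hf) ?_
    rw [hP, hγo]
    exact hu
  rw [h2, pullback_symm_pullback]
  exact hi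

theorem isInvariant_pullback_symm (k : ℕ) [TopologicalSpace G]
    [ChartedSpace (EuclideanSpace ℝ (Fin k)) G] [ContMDiffSMul (𝓡 k) (𝓡 n) ∞ G M]
    (hq : IsPreferredDirection Γ q)
    (ho : ∀ x : M, ∃ a : G, a • o = x) (hreg : IsSmoothOnInvariants G o Γ q)
    (hJ : IsOpen J) (hJc : J.OrdConnected) (hflow : IsFlowSolution Γ q J γt)
    (hinv : ∀ t ∈ J, IsInvariant G (γt t))
    {f : Diff n M} (hfo : f o = o) (hf : ∀ a : G, ∃ b : G, ∀ x, f (a • x) = b • f x)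
    {t : ℝ} (ht : t ∈ J) (h : IsInvariant G (pullback f.symm (γt t))) {u : ℝ} (hu : u ∈ J) :
    IsInvariant G (pullback f.symm (γt u)) := by
  let C : Set ℝ := {u | u ∈ J ∧ IsInvariant G (pullback f.symm (γt u))}
  have hC : IsOpen C := by
    rw [isOpen_iff_mem_nhds]
    rintro v ⟨hv, hi⟩
    filter_upwards [hJ.mem_nhds hv,
      eventually_isInvariant_pullback_symm k hq ho hreg hJ hflow hinv hfo hf hv hi]
      with w h1 h2 using ⟨h1, h2⟩
  refine (hJc.isPreconnected.subset_of_closure_inter_subset hC ⟨t, ht, ht, h⟩ ?_ hu).2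
  -- Closedness in `J`: invariance under `a` at the point `x` equates two functions of time that are
  -- continuous at `v`.
  rintro v ⟨hvC, hv⟩
  refine ⟨hv, (isInvariant_iff k).2 fun a => funext fun x => ?_⟩
  have hderiv : ∀ x, HasDerivAt (fun u => pullback f.symm (γt u) x)
      (pullback f.symm (q (γt v)) x) v := fun x =>
    Tensors.hasDerivAt_pull _ _ ((hflow v hv).2 (f.symm x))
  have hcont' : ContinuousAt
      (fun u => pullback (actionDiffeo k a) (pullback f.symm (γt u)) x) v :=
    (Tensors.hasDerivAt_pull _ _ (hderiv (a • x))).continuousAt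
  have h1 := (hcont'.prodMk (hderiv x).continuousAt).tendsto
  refine (isClosed_diagonal.mem_of_frequently_of_tendsto ?_ h1 :)
  refine (mem_closure_iff_frequently.1 hvC).mono fun w hw => ?_
  exact congrFun ((isInvariant_iff k).1 hw.2 a) x

theorem exists_normalizing_diffeo (k : ℕ) [TopologicalSpace G]
    [ChartedSpace (EuclideanSpace ℝ (Fin k)) G] [ContMDiffSMul (𝓡 k) (𝓡 n) ∞ G M]
    {γ : TensorField r s n M} (hq : IsPreferredDirection Γ q)
    (hhom : IsHomogeneous γ) (hG : IsAutomorphismGroup G γ) (hreg : IsSmoothOnInvariants G o Γ q)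
    (hJ : IsOpen J) (hJc : J.OrdConnected) (h0 : (0 : ℝ) ∈ J) (hγ0 : γt 0 = γ)
    (hflow : IsFlowSolution Γ q J γt) (hinv : ∀ t ∈ J, IsInvariant G (γt t))
    {t : ℝ} (ht : t ∈ J) {c : ℝ} (hc : c ≠ 0) {f₀ : Diff n M}
    (hf₀ : γt t = c • pullback f₀ γ) :
    ∃ (f : Diff n M) (φ : G ≃* G), f o = o ∧ γt t = c • pullback f γ ∧
      ∀ (a : G) x, f (a • x) = φ a • f x := by
  have ho : ∀ x : M, ∃ a : G, a • o = x := hG.exists_smul_eq hhom o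
  -- Following `f₀` by an automorphism of `γ` leaves `f₀^*γ` unchanged, so the origin may be assumed
  -- fixed.
  obtain ⟨a, ha⟩ := hG.exists_smul_eq hhom (f₀ o) o
  let f : Diff n M := f₀.trans (actionDiffeo k a)
  have hfo : f o = o := ha
  have hfγ : pullback f γ = pullback f₀ γ := by
    rw [pullback_trans, (isInvariant_iff k).1 hG.isInvariant a]
  rw [← hfγ] at hf₀
  have h1 : pullback f γ = c⁻¹ • γt t := by rw [hf₀, inv_smul_smul₀ hc]
  have h2 : IsInvariant G (pullback f γ) := (isInvariant_iff k).2 fun b => by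
    rw [h1, pullback_smul, (isInvariant_iff k).1 (hinv t ht) b]
  have h3 := exists_smul_apply_of_pullback_eq k hG h2
  have h4 : IsInvariant G (pullback f.symm (γt t)) := (isInvariant_iff k).2 fun b => by
    rw [hf₀, pullback_smul, pullback_symm_pullback, pullback_smul,
      (isInvariant_iff k).1 hG.isInvariant b]
  have h5 := isInvariant_pullback_symm k hq ho hreg hJ hJc hflow hinv hfo h3 ht h4 h0
  rw [hγ0] at h5
  obtain ⟨φ, hφ⟩ := exists_mulEquiv_of_normalizes hG.effective f.toEquiv h3
    (exists_smul_apply_of_pullback_eq k hG h5)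
  exact ⟨f, φ, hfo, hf₀, hφ⟩

end Normalize

/-! ### Automorphisms of the group induced by diffeomorphisms -/

section Continuity

variable {G M : Type*} [Group G] [TopologicalSpace G] [IsTopologicalGroup G] [T2Space G]
  [LocallyCompactSpace G] [SecondCountableTopology G] [TopologicalSpace M] [T2Space M]
  [MulAction G M] [ContinuousSMul G M]

/-- By effectiveness the graph of `φ` is cut out by the closed conditions `f(a x) = b f(x)`. It is
therefore a σ-compact group, and its projection onto the first factor is open by the open mapping
theorem for groups. -/
theorem continuous_of_forall_apply_smul (heff : ∀ a b : G, (∀ x : M, a • x = b • x) → a = b)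
    (f : M ≃ₜ M) (φ : G ≃* G) (hφ : ∀ a x, f (a • x) = φ a • f x) : Continuous φ := by
  let H : Subgroup (G × G) := φ.toMonoidHom.graph
  have hH : (H : Set (G × G)) = ⋂ x : M, {p | f (p.1 • x) = p.2 • f x} := by
    ext p
    simp only [Set.mem_iInter, Set.mem_ofPred_eq, hφ, SetLike.mem_coe]
    exact ⟨fun h x => congrArg (· • f x) h, fun h => heff _ _ fun x => by
      simpa using h (f.symm x)⟩
  have hHc : IsClosed (H : Set (G × G)) := by
    rw [hH]
    exact isClosed_iInter fun x => isClosed_eq (by fun_prop) (by fun_prop)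
  have : SecondCountableTopology H :=
    TopologicalSpace.Subtype.secondCountableTopology (H : Set (G × G))
  have : LocallyCompactSpace H := hHc.isClosedEmbedding_subtypeVal.locallyCompactSpace
  let π : H →* G := (MonoidHom.fst G G).comp H.subtype
  have hπ : Continuous π := continuous_fst.comp continuous_subtype_val
  have ho : IsOpenMap π := π.isOpenMap_of_sigmaCompact (fun a => ⟨⟨(a, φ a), rfl⟩, rfl⟩) hπ
  refine continuous_def.2 fun U hU => ?_
  have h1 : φ ⁻¹' U = π '' {p : H | p.1.2 ∈ U} := by
    ext a
    constructor
    · exact fun h => ⟨⟨(a, φ a), rfl⟩, h, rfl⟩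
    · rintro ⟨⟨⟨a', b⟩, hb : φ a' = b⟩, h, rfl⟩
      exact (congrArg (· ∈ U) hb).mpr h
  rw [h1]
  exact ho _ (hU.preimage (continuous_snd.comp continuous_subtype_val))

end Continuity

/-- Among finite intersections of kernels there is a minimal one, by finite dimension. Adding a
further kernel cannot shrink it, so it lies in every kernel. -/
theorem exists_finset_iInf_ker_eq_bot {ι V W : Type*} [AddCommGroup V] [Module ℝ V]
    [FiniteDimensional ℝ V] [AddCommGroup W] [Module ℝ W] (T : ι → V →ₗ[ℝ] W)
    (h : ∀ v, (∀ i, T i v = 0) → v = 0) :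
    ∃ s : Finset ι, ∀ v, (∀ i ∈ s, T i v = 0) → v = 0 := by
  classical
  let A : Set (Submodule ℝ V) := Set.range fun s : Finset ι => ⨅ i ∈ s, LinearMap.ker (T i)
  obtain ⟨_, ⟨s, rfl⟩, hs⟩ := WellFounded.has_min (wellFounded_lt (α := Submodule ℝ V)) A
    ⟨_, ∅, rfl⟩
  refine ⟨s, fun v hv => h v fun j => ?_⟩
  by_contra hj
  refine hs _ ⟨insert j s, rfl⟩ (lt_of_le_of_ne ?_ fun he => hj ?_)
  · exact biInf_mono fun i hi => Finset.mem_insert_of_mem hi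
  · have h1 : v ∈ ⨅ i ∈ s, LinearMap.ker (T i) := by simpa using hv
    dsimp only at he
    rw [← he] at h1
    simp only [Submodule.mem_iInf] at h1
    exact h1 j (Finset.mem_insert_self j s)

/-! ### Smoothness of the induced automorphism -/

section Smoothness

variable {n k : ℕ}
  {M : Type*} [TopologicalSpace M] [ChartedSpace (EuclideanSpace ℝ (Fin n)) M]
  {G : Type*} [Group G] [TopologicalSpace G] [ChartedSpace (EuclideanSpace ℝ (Fin k)) G]
  [MulAction G M] [ContMDiffSMul (𝓡 k) (𝓡 n) ∞ G M]

theorem contMDiff_smul_left (x : M) : ContMDiff (𝓡 k) (𝓡 n) ∞ fun a : G => a • x :=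
  ContMDiff.smul (I := 𝓡 k) (I' := 𝓡 n) contMDiff_id contMDiff_const

variable [LieGroup (𝓡 k) ∞ G]

/-- The differential of an orbit map vanishes at every point in the direction of a left invariant
vector field if it does so at the identity. -/
theorem mfderiv_smul_mulInvariantVectorField_eq_zero {x : M} {v : GroupLieAlgebra (𝓡 k) G}
    (h : mfderiv (𝓡 k) (𝓡 n) (fun a : G => a • x) 1 v = 0) (g : G) :
    mfderiv (𝓡 k) (𝓡 n) (fun a : G => a • x) g (mulInvariantVectorField v g) = 0 := by
  have h1 : MDifferentiableAt (𝓡 k) (𝓡 n) (fun a : G => a • x) (g * 1) :=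
    (contMDiff_smul_left x).mdifferentiable (by simp) _
  have h2 : MDifferentiableAt (𝓡 k) (𝓡 k) (fun a : G => g * a) 1 :=
    (contMDiff_mul_left (I := 𝓡 k) (n := ∞) (a := g)).mdifferentiable (by simp) _
  have h3 : MDifferentiableAt (𝓡 n) (𝓡 n) (fun x : M => g • x) ((1 : G) • x) :=
    (actionDiffeo k g).contMDiff.mdifferentiable (by simp) _
  have h4 : MDifferentiableAt (𝓡 k) (𝓡 n) (fun a : G => a • x) 1 :=
    (contMDiff_smul_left x).mdifferentiable (by simp) _
  have h5 := mfderiv_comp (1 : G) h1 h2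
  have h6 := mfderiv_comp (1 : G) h3 h4
  have h7 : (fun a : G => a • x) ∘ (fun a => g * a) = (fun x => g • x) ∘ fun a : G => a • x :=
    funext fun a => mul_smul g a x
  rw [h7, h6] at h5
  have h8 := congrArg (fun L => L v) h5
  rw [mul_one] at h8
  refine Eq.trans (h8.symm :) ?_
  exact (congrArg (mfderiv (𝓡 n) (𝓡 n) (fun x : M => g • x) ((1 : G) • x)) h).trans
    (ContinuousLinearMap.map_zero _)

variable [IsManifold (𝓡 n) ∞ M] [T2Space M]

/-- Infinitesimal effectiveness. Let `c` be the integral curve through `1` of the left invariant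
field of `v`. Each `c(t) • x` has zero velocity, so `c(t)` fixes every point; thus `c` is constant
and `v = c'(0) = 0`. -/
theorem eq_zero_of_forall_mfderiv_smul_eq_zero
    (heff : ∀ a b : G, (∀ x : M, a • x = b • x) → a = b) {v : GroupLieAlgebra (𝓡 k) G}
    (h : ∀ x : M, mfderiv (𝓡 k) (𝓡 n) (fun a : G => a • x) 1 v = 0) : v = 0 := by
  have : IsManifold (𝓡 k) 1 G := .of_le (n := ∞) (by simp)
  have : IsManifold (𝓡 n) 1 M := .of_le (n := ∞) (by simp)
  obtain ⟨c, hc0, hc⟩ := exists_isMIntegralCurveAt_of_contMDiffAt_boundaryless (I := 𝓡 k) 0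
    (x₀ := (1 : G)) (v := mulInvariantVectorField v)
    ((contMDiff_mulInvariantVectorField v).contMDiffAt.of_le
      (le_trans (by norm_num) le_minSmoothness))
  obtain ⟨ε, hε, hc'⟩ := isMIntegralCurveAt_iff'.1 hc
  rw [Real.ball_eq_Ioo] at hc'
  have h0 : (0 : ℝ) ∈ Set.Ioo (0 - ε) (0 + ε) := by constructor <;> linarith
  have hzero : ∀ {t : ℝ} {s : Set ℝ} {d : ℝ → M} {L},
      HasMFDerivWithinAt 𝓘(ℝ, ℝ) (𝓡 n) d s t L → L = 0 → HasMFDerivWithinAt 𝓘(ℝ, ℝ) (𝓡 n) d s t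
        ((1 : ℝ →L[ℝ] ℝ).smulRight (0 : TangentSpace (𝓡 n) (d t))) := by
    intro t s d L h hL
    have h1 : (1 : ℝ →L[ℝ] ℝ).smulRight (0 : TangentSpace (𝓡 n) (d t)) = 0 :=
      ContinuousLinearMap.ext fun u => smul_zero (A := TangentSpace (𝓡 n) (d t)) u
    have h2 : HasMFDerivWithinAt 𝓘(ℝ, ℝ) (𝓡 n) d s t 0 := hL ▸ h
    exact (congrArg (HasMFDerivWithinAt 𝓘(ℝ, ℝ) (𝓡 n) d s t) h1).mpr h2
  have h1 : ∀ x : M, Set.EqOn (fun t => c t • x) (fun _ => x) (Set.Ioo (0 - ε) (0 + ε)) := by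
    intro x
    refine isMIntegralCurveOn_Ioo_eqOn_of_contMDiff_boundaryless (I := 𝓡 n) (v := fun _ => 0) h0
      ?_ ?_ ?_ ?_
    · exact Bundle.contMDiff_zeroSection _ _
    · intro t ht
      have h2 := ((contMDiff_smul_left (k := k) (n := n) x).mdifferentiable (by simp)
        (c t)).hasMFDerivAt.comp_hasMFDerivWithinAt t (hc' t ht)
      refine hzero h2 ?_
      refine ContinuousLinearMap.ext fun u => ?_
      change mfderiv (𝓡 k) (𝓡 n) (fun a : G => a • x) (c t)
        ((show ℝ from u) • mulInvariantVectorField v (c t)) = 0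
      rw [ContinuousLinearMap.map_smul, mfderiv_smul_mulInvariantVectorField_eq_zero (h x),
        smul_zero]
    · exact fun t ht => hzero (hasMFDerivWithinAt_const _ _ _) rfl
    · rw [hc0, one_smul]
  have h2 : ∀ t ∈ Set.Ioo (0 - ε) (0 + ε), c t = 1 := fun t ht =>
    heff _ _ fun x => (h1 x ht).trans (one_smul G x).symm
  have h3 : HasMFDerivAt 𝓘(ℝ, ℝ) (𝓡 k) c 0 ((1 : ℝ →L[ℝ] ℝ).smulRight
      (mulInvariantVectorField v (c 0))) := (hc' 0 h0).hasMFDerivAt (isOpen_Ioo.mem_nhds h0)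
  have h4 : HasMFDerivAt 𝓘(ℝ, ℝ) (𝓡 k) c 0 0 := (hasMFDerivAt_const (1 : G) (0 : ℝ)).congr_of_eventuallyEq
    (Filter.eventually_of_mem (isOpen_Ioo.mem_nhds h0) h2)
  have h5 := congrArg (fun L => L 1) (hasMFDerivAt_unique h3 h4)
  have h6 : mulInvariantVectorField v (c 0) = 0 := (one_smul ℝ _).symm.trans h5
  rw [hc0] at h6
  have h7 : mulInvariantVectorField v (1 : G) = v := by
    have h8 : (fun x : G => 1 * x) = id := funext one_mul
    simp only [mulInvariantVectorField]
    rw [h8]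
    exact congrArg (fun L => L v) (mfderiv_id (I := 𝓡 k) (x := (1 : G)))
  exact h7.symm.trans h6

/-- Near the identity, an element `a` of the group is a smooth function of finitely many points
`a • x`. -/
theorem exists_extChartAt_eq_of_smul (heff : ∀ a b : G, (∀ x : M, a • x = b • x) → a = b) :
    ∃ (s : Finset M) (Ψ : (s → EuclideanSpace ℝ (Fin n)) → EuclideanSpace ℝ (Fin k)),
      ContDiffAt ℝ ∞ Ψ (fun i : s => extChartAt (𝓡 n) (i : M) i) ∧
      ∀ᶠ a in 𝓝 (1 : G), extChartAt (𝓡 k) (1 : G) a =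
        Ψ fun i => extChartAt (𝓡 n) (i : M) (a • (i : M)) := by
  let T : M → EuclideanSpace ℝ (Fin k) →ₗ[ℝ] EuclideanSpace ℝ (Fin n) := fun x =>
    (differential (n := k) (n' := n) (fun a : G => a • x) 1).toLinearMap
  obtain ⟨s, hs⟩ := exists_finset_iInf_ker_eq_bot T
    fun v hv => eq_zero_of_forall_mfderiv_smul_eq_zero (G := G) heff fun x => hv x
  let χ := extChartAt (𝓡 k) (1 : G)
  let e := χ 1
  have hχe : χ.symm e = 1 := extChartAt_to_inv (I := 𝓡 k) (1 : G)
  let g : EuclideanSpace ℝ (Fin k) → (s → EuclideanSpace ℝ (Fin n)) := fun y i =>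
    extChartAt (𝓡 n) (i : M) (χ.symm y • (i : M))
  have hχ : ContMDiffAt 𝓘(ℝ, EuclideanSpace ℝ (Fin k)) (𝓡 k) ∞ χ.symm e :=
    (contMDiffOn_extChartAt_symm (1 : G)).contMDiffAt (extChartAt_target_mem_nhds (1 : G))
  have hev : ∀ x : M, ContMDiffAt 𝓘(ℝ, EuclideanSpace ℝ (Fin k)) (𝓡 n) ∞
      (fun y => χ.symm y • x) e := fun x =>
    (contMDiff_smul_left (k := k) (n := n) x).contMDiffAt.comp e hχ
  have hex : ∀ x : M, ContMDiffAt (𝓡 n) 𝓘(ℝ, EuclideanSpace ℝ (Fin n)) ∞ (extChartAt (𝓡 n) x)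
      (χ.symm e • x) := fun x => by
    rw [hχe, one_smul]
    exact contMDiffAt_extChartAt
  have hgi : ∀ i : s, ContDiffAt ℝ ∞ (fun y => g y i) e := fun i =>
    ((hex i).comp e (hev i)).contDiffAt
  have hg : ContDiffAt ℝ ∞ g e := contDiffAt_pi.2 hgi
  -- The charts have invertible differentials, and the finitely many orbit maps have no common
  -- kernel by the choice of `s`.
  have hinj : Function.Injective (fderiv ℝ g e) := by
    rw [injective_iff_map_eq_zero]
    intro v hv
    have hB : Function.Injective (differential (n := k) (n' := k) χ.symm e) := by
      have h1 := isInvertible_mfderivWithin_extChartAt_symm (I := 𝓡 k) (x := (1 : G))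
        (mem_extChartAt_target (1 : G))
      rw [ModelWithCorners.range_eq_univ, mfderivWithin_univ] at h1
      exact h1.injective
    refine hB (Eq.trans (hs _ fun x hx => ?_)
      (ContinuousLinearMap.map_zero _).symm)
    have hA : Function.Injective (differential (n := n) (n' := n) (extChartAt (𝓡 n) x)
        (χ.symm e • x)) := by
      rw [hχe, one_smul]
      exact (isInvertible_mfderiv_extChartAt (mem_extChartAt_source x)).injective
    refine hA (Eq.trans ?_ (ContinuousLinearMap.map_zero _).symm)
    have h1 : fderiv ℝ (fun y => extChartAt (𝓡 n) x (χ.symm y • x)) e v = 0 := by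
      rw [(hasFDerivAt_pi'.1 (hg.differentiableAt (by simp)).hasFDerivAt ⟨x, hx⟩).fderiv]
      change fderiv ℝ g e v ⟨x, hx⟩ = 0
      rw [hv]
      rfl
    have h2 : fderiv ℝ (fun y => extChartAt (𝓡 n) x (χ.symm y • x)) e =
        differential (n := k) (n' := n) (extChartAt (𝓡 n) x ∘ (fun a : G => a • x) ∘ χ.symm) e :=
      mfderiv_eq_fderiv.symm
    rw [h2, differential_comp (n₁ := k) (n₂ := n) (n₃ := n) (f := (fun a : G => a • x) ∘ χ.symm) e
      ((hex x).mdifferentiableAt (by simp)) ((hev x).mdifferentiableAt (by simp)),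
      differential_comp (n₁ := k) (n₂ := k) (n₃ := n) e
      ((contMDiff_smul_left (k := k) (n := n) x).contMDiffAt.mdifferentiableAt (by simp))
      (hχ.mdifferentiableAt (by simp))] at h1
    change differential (n := n) (n' := n) (extChartAt (𝓡 n) x) (χ.symm e • x)
      (differential (n := k) (n' := n) (fun a : G => a • x) (χ.symm e)
        (differential (n := k) (n' := k) χ.symm e v)) = 0 at h1
    rw [hχe] at h1
    rw [hχe]
    exact h1
  -- A left inverse of the injective differential gives `ℓ ∘ g` the identity as differential, so the
  -- inverse function theorem recovers the coordinates of `a` from `g`.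
  obtain ⟨ℓ, hℓ⟩ := (fderiv ℝ g e).toLinearMap.exists_leftInverse_of_injective
    (LinearMap.ker_eq_bot.2 hinj)
  let ℓ' := ℓ.toContinuousLinearMap
  have hk : ContDiffAt ℝ ∞ (fun y => ℓ' (g y)) e := ℓ'.contDiff.contDiffAt.comp e hg
  have hk' : HasFDerivAt (fun y => ℓ' (g y))
      (ContinuousLinearEquiv.refl ℝ (EuclideanSpace ℝ (Fin k)) :
        EuclideanSpace ℝ (Fin k) →L[ℝ] EuclideanSpace ℝ (Fin k)) e := by
    have h1 := ℓ'.hasFDerivAt.comp e (hg.differentiableAt (by simp)).hasFDerivAt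
    have h2 : ℓ' ∘L fderiv ℝ g e = (ContinuousLinearEquiv.refl ℝ (EuclideanSpace ℝ (Fin k)) :
        EuclideanSpace ℝ (Fin k) →L[ℝ] EuclideanSpace ℝ (Fin k)) :=
      ContinuousLinearMap.ext fun v => LinearMap.congr_fun hℓ v
    rw [← h2]
    exact h1
  let ψ := hk.localInverse hk' (by simp)
  have hψ : ContDiffAt ℝ ∞ ψ (ℓ' (g e)) := hk.to_localInverse hk' (by simp)
  have hψe : ∀ᶠ y in 𝓝 e, ψ (ℓ' (g y)) = y :=
    (hk.hasStrictFDerivAt' hk' (by simp)).eventually_left_inverse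
  have hge : g e = fun i : s => extChartAt (𝓡 n) (i : M) i := by
    funext i
    simp only [g, hχe, one_smul]
  refine ⟨s, fun z => ψ (ℓ' z), ?_, ?_⟩
  · rw [← hge]
    exact hψ.comp _ ℓ'.contDiff.contDiffAt
  · have h1 : Filter.Tendsto χ (𝓝 1) (𝓝 e) := continuousAt_extChartAt (1 : G)
    filter_upwards [h1.eventually hψe, extChartAt_source_mem_nhds (I := 𝓡 k) (1 : G)] with a h2 h3
    have h4 : χ.symm (χ a) = a := χ.left_inv h3
    simp only [g, h4] at h2
    exact h2.symm

/-- Near `1`, the coordinates of `φ(a)` are a smooth function of the points `φ(a) • xᵢ = f(a •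
f⁻¹(xᵢ))`, which depend smoothly on `a`. Continuity of `φ` keeps `φ(a)` where this description is
valid, and translations spread smoothness to all of `G`. -/
theorem contMDiff_of_forall_apply_smul (heff : ∀ a b : G, (∀ x : M, a • x = b • x) → a = b)
    (f : Diff n M) (φ : G ≃* G) (hφ : ∀ (a : G) x, f (a • x) = φ a • f x) (hφc : Continuous φ) :
    ContMDiff (𝓡 k) (𝓡 k) ∞ φ := by
  obtain ⟨s, Ψ, hΨ, h⟩ := exists_extChartAt_eq_of_smul (n := n) (k := k) heff
  have h1 : ContMDiffAt (𝓡 k) (𝓡 k) ∞ φ 1 := by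
    refine contMDiffAt_iff_target.2 ⟨hφc.continuousAt, ?_⟩
    rw [map_one]
    have h2 : ∀ (a : G) x, φ a • x = f (a • f.symm x) := fun a x => by
      rw [hφ, f.apply_symm_apply]
    have h3 : ContMDiffAt (𝓡 k) 𝓘(ℝ, s → EuclideanSpace ℝ (Fin n)) ∞
        (fun (a : G) (i : s) => extChartAt (𝓡 n) (i : M) (f (a • f.symm i))) 1 := by
      refine contMDiffAt_pi_space.2 fun i => ?_
      have h4 : ContMDiffAt (𝓡 n) 𝓘(ℝ, EuclideanSpace ℝ (Fin n)) ∞ (extChartAt (𝓡 n) (i : M))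
          (f ((1 : G) • f.symm i)) := by
        rw [one_smul, f.apply_symm_apply]
        exact contMDiffAt_extChartAt
      exact h4.comp (1 : G) ((f.contMDiff.comp
        (contMDiff_smul_left (k := k) (n := n) (f.symm (i : M)))).contMDiffAt (x := (1 : G)))
    have h5 : ContDiffAt ℝ ∞ Ψ
        ((fun (a : G) (i : s) => extChartAt (𝓡 n) (i : M) (f (a • f.symm i))) 1) := by
      simpa only [one_smul, f.apply_symm_apply] using hΨ
    refine (h5.contMDiffAt.comp (1 : G) h3).congr_of_eventuallyEq ?_
    have h6 : Filter.Tendsto φ (𝓝 1) (𝓝 1) := by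
      simpa using hφc.tendsto 1
    filter_upwards [h6.eventually h] with a ha
    simp only [Function.comp_apply, ha, h2]
  intro g
  have h2 : (φ : G → G) = (fun b => φ g * b) ∘ φ ∘ fun a => g⁻¹ * a := by
    funext a
    simp [map_mul]
  rw [h2]
  refine (contMDiff_mul_left.contMDiffAt).comp g (ContMDiffAt.comp g ?_
    (contMDiff_mul_left.contMDiffAt))
  rwa [inv_mul_cancel]

end Smoothness

/-! ### The bracket of the Lie algebra as a tensor -/

section BracketTensor

variable {E : Type*} [NormedAddCommGroup E] [NormedSpace ℝ E] [FiniteDimensional ℝ E]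

/-- A bilinear map as a continuous multilinear map. -/
def bilinToMultilinear (B : E →ₗ[ℝ] E →ₗ[ℝ] E) :
    ContinuousMultilinearMap ℝ (fun _ : Fin 2 => E) E where
  toFun v := B (v 0) (v 1)
  map_update_add' := by
    intro inst v i x y
    rw [Subsingleton.elim inst (instDecidableEqFin 2)]
    fin_cases i <;> simp
  map_update_smul' := by
    intro inst v i c x
    rw [Subsingleton.elim inst (instDecidableEqFin 2)]
    fin_cases i <;> simp
  cont := by
    let B' : E →L[ℝ] E →L[ℝ] E :=
      (LinearMap.toContinuousLinearMap.toLinearMap ∘ₗ B).toContinuousLinearMap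
    exact (B'.continuous.comp (continuous_apply 0)).clm_apply (continuous_apply 1)

/-- A bilinear product on `E` as a tensor of type `(2, 1)`. -/
def bilinTensor (B : E →ₗ[ℝ] E →ₗ[ℝ] E) : BracketTensor E := fun _ =>
  ContinuousMultilinearMap.ofSubsingleton ℝ (E →L[ℝ] ℝ)
    (ContinuousMultilinearMap ℝ (fun _ : Fin 2 => E) ℝ) (0 : Fin 1)
    ((ContinuousLinearMap.compContinuousMultilinearMapL ℝ (fun _ : Fin 2 => E) E ℝ).flip
      (bilinToMultilinear B))

theorem bilinTensor_apply (B : E →ₗ[ℝ] E →ₗ[ℝ] E) (i : Fin 1) (ξ : Fin 1 → E →L[ℝ] ℝ)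
    (v : Fin 2 → E) : bilinTensor B i ξ v = ξ 0 (B (v 0) (v 1)) := rfl

theorem pull_bilinTensor (B : E →ₗ[ℝ] E →ₗ[ℝ] E) {L L' : E →L[ℝ] E} (h : L'.comp L = .id ℝ E)
    (hB : ∀ v w, L (B v w) = B (L v) (L w)) :
    Tensors.pull L L' (bilinTensor B) = bilinTensor B := by
  funext i
  ext ξ v
  change ξ 0 (L' (B (L (v 0)) (L (v 1)))) = ξ 0 (B (v 0) (v 1))
  rw [← hB]
  exact congrArg (ξ 0) (DFunLike.congr_fun h _)

/-- Evaluate the tensor equation on one covector and two vectors; covectors separate points. -/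
theorem leibniz_of_theta_bilinTensor (B : E →ₗ[ℝ] E →ₗ[ℝ] E) {D : E →L[ℝ] E}
    (h : Tensors.theta D (bilinTensor B) = 0) (v w : E) :
    D (B v w) = B (D v) w + B v (D w) := by
  refine eq_of_sub_eq_zero (SeparatingDual.eq_zero_of_forall_dual_eq_zero (R := ℝ) fun ξ => ?_)
  have h1 : Tensor.theta D (bilinTensor B 0) (fun _ => ξ) ![v, w] = 0 := by
    have h2 := congrFun h 0
    change Tensor.theta D (bilinTensor B 0) = 0 at h2
    rw [h2]
    rfl
  rw [Tensor.theta_apply] at h1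
  simp only [bilinTensor_apply, Fin.sum_univ_two, Fin.sum_univ_one] at h1
  simp at h1
  simp only [map_sub, map_add]
  linarith

end BracketTensor

/-! ### Differentials of Lie group automorphisms -/

section Automorphism

variable {k : ℕ}
  {G : Type*} [Group G] [TopologicalSpace G] [ChartedSpace (EuclideanSpace ℝ (Fin k)) G]

theorem isInvertible_mfderiv_mulEquiv {φ : G ≃* G} (hφ : ContMDiff (𝓡 k) (𝓡 k) ∞ φ)
    (hφ' : ContMDiff (𝓡 k) (𝓡 k) ∞ φ.symm) (g : G) :
    (mfderiv (𝓡 k) (𝓡 k) φ g).IsInvertible :=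
  ⟨(⟨φ.toEquiv, hφ, hφ'⟩ : Diffeomorph (𝓡 k) (𝓡 k) G G ∞).mfderivToContinuousLinearEquiv
    (by simp) g, rfl⟩

variable [LieGroup (𝓡 k) ∞ G]

/-- The differential at the identity of a map of the group to itself. -/
def groupDifferential (φ : G → G) :
    GroupLieAlgebra (𝓡 k) G →L[ℝ] GroupLieAlgebra (𝓡 k) G :=
  differential (n := k) (n' := k) φ (1 : G)

/-- Differentiate `φ(g x) = φ(g) φ(x)` with respect to `x` at the identity. -/
theorem mfderiv_mulInvariantVectorField {φ : G →* G} (hφ : ContMDiff (𝓡 k) (𝓡 k) ∞ φ)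
    (v : GroupLieAlgebra (𝓡 k) G) (g : G) :
    mfderiv (𝓡 k) (𝓡 k) φ g (mulInvariantVectorField v g) =
      (mulInvariantVectorField
        (groupDifferential φ v) (φ g) :) := by
  have hmul : ∀ a b : G, MDifferentiableAt (𝓡 k) (𝓡 k) (fun x : G => a * x) b := fun a b =>
    (contMDiff_mul_left (I := 𝓡 k) (n := ∞) (a := a)).mdifferentiable (by simp) _
  have hd : ∀ g, MDifferentiableAt (𝓡 k) (𝓡 k) φ g := hφ.mdifferentiable (by simp)
  have h1 : differential (n := k) (n' := k) (φ ∘ fun x => g * x) 1 =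
      (differential (n := k) (n' := k) φ (g * 1)).comp (differential (fun x => g * x) 1) :=
    differential_comp 1 (hd _) (hmul g 1)
  have h2 : differential (n := k) (n' := k) ((fun x => φ g * x) ∘ φ) 1 =
      (differential (n := k) (n' := k) (fun x => φ g * x) (φ 1)).comp (differential φ 1) :=
    differential_comp 1 (hmul _ _) (hd 1)
  have h3 : φ ∘ (fun x => g * x) = (fun x => φ g * x) ∘ φ := funext fun x => map_mul φ g x
  rw [h3, h2, map_one, mul_one] at h1
  exact (DFunLike.congr_fun h1 v).symm

/-- The field generated by `dφ(v)` pulls back under `φ` to the one generated by `v`. Pull-back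
respects brackets of vector fields, and the identity is read off at `1`. -/
theorem groupDifferential_lie {φ : G ≃* G} (hφ : ContMDiff (𝓡 k) (𝓡 k) ∞ φ)
    (hφ' : ContMDiff (𝓡 k) (𝓡 k) ∞ φ.symm) (v w : GroupLieAlgebra (𝓡 k) G) :
    groupDifferential φ ⁅v, w⁆ =
      ⁅(groupDifferential φ v),
        (groupDifferential φ w)⁆ := by
  have hp : ∀ v : GroupLieAlgebra (𝓡 k) G, VectorField.mpullback (𝓡 k) (𝓡 k) φ
      (mulInvariantVectorField
        (groupDifferential φ v)) =
      mulInvariantVectorField v := by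
    intro v
    funext g
    refine ((isInvertible_mfderiv_mulEquiv hφ hφ' g).inverse_apply_eq).2 ?_
    exact (mfderiv_mulInvariantVectorField (φ := φ.toMonoidHom) hφ v g).symm
  have h := VectorField.mpullback_mlieBracket (I := 𝓡 k) (I' := 𝓡 k) (n := ∞) (x₀ := (1 : G))
    (f := φ)
    (mdifferentiableAt_mulInvariantVectorField
      (groupDifferential φ v))
    (mdifferentiableAt_mulInvariantVectorField
      (groupDifferential φ w))
    hφ.contMDiffAt (by
      rw [minSmoothness_of_isRCLikeNormedField]
      exact WithTop.coe_le_coe.2 (le_top (a := (2 : ℕ∞))))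
  rw [hp, hp] at h
  have h1 := ((isInvertible_mfderiv_mulEquiv hφ hφ' 1).inverse_apply_eq).1 h
  rw [map_one] at h1
  exact h1.symm

end Automorphism

/-! ### Normalizing diffeomorphisms and the self-similar flow -/

section Normalizing

variable {n k : ℕ}
  {M : Type*} [TopologicalSpace M] [ChartedSpace (EuclideanSpace ℝ (Fin n)) M]
  {G : Type*} [Group G] [MulAction G M]

theorem symm_normalizes {f : Diff n M} {φ : G ≃* G} (hφ : ∀ (a : G) x, f (a • x) = φ a • f x)
    (a : G) (x : M) : f.symm (a • x) = φ.symm a • f.symm x := by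
  apply f.injective
  change f (f.symm (a • x)) = f (φ.symm a • f.symm x)
  rw [hφ, f.apply_symm_apply, f.apply_symm_apply, φ.apply_symm_apply]

variable [TopologicalSpace G] [ChartedSpace (EuclideanSpace ℝ (Fin k)) G]
  [ContMDiffSMul (𝓡 k) (𝓡 n) ∞ G M]

/-- Differentiate `f ∘ π = π ∘ φ` at the identity, where `π(a) = a • o`. -/
theorem differential_comp_dProj {o : M} {f : Diff n M} (hfo : f o = o) {φ : G ≃* G}
    (hφs : ContMDiff (𝓡 k) (𝓡 k) ∞ φ) (hφ : ∀ (a : G) x, f (a • x) = φ a • f x) :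
    (differential (n := n) (n' := n) f o).comp
        (differential (n := k) (n' := n) (fun a : G => a • o) 1) =
      (differential (n := k) (n' := n) (fun a : G => a • o) 1).comp
        (differential (n := k) (n' := k) φ 1) := by
  have hev : ∀ g : G, MDifferentiableAt (𝓡 k) (𝓡 n) (fun a : G => a • o) g :=
    (contMDiff_smul_left o).mdifferentiable (by simp)
  have h1 := differential_comp (n₁ := k) (n₂ := n) (n₃ := n) (1 : G)
    (Diff.mdifferentiableAt f ((1 : G) • o)) (hev 1)
  have h2 := differential_comp (n₁ := k) (n₂ := k) (n₃ := n) (1 : G) (hev (φ 1))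
    (hφs.mdifferentiable (by simp) 1)
  have h3 : f ∘ (fun a : G => a • o) = (fun a : G => a • o) ∘ φ := funext fun a => by
    simp only [Function.comp_apply, hφ, hfo]
  rw [h3, h2, map_one, one_smul] at h1
  exact h1.symm

variable [IsManifold (𝓡 n) ∞ M] [T2Space M] [LieGroup (𝓡 k) ∞ G] [T2Space G]
  [SecondCountableTopology G]

theorem contMDiff_of_normalizes (heff : ∀ a b : G, (∀ x : M, a • x = b • x) → a = b)
    (f : Diff n M) (φ : G ≃* G) (hφ : ∀ (a : G) x, f (a • x) = φ a • f x) :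
    ContMDiff (𝓡 k) (𝓡 k) ∞ φ := by
  have : IsTopologicalGroup G := topologicalGroup_of_lieGroup (𝓡 k) ∞
  have : LocallyCompactSpace G := ChartedSpace.locallyCompactSpace (EuclideanSpace ℝ (Fin k)) G
  have : ContinuousSMul G M := ContMDiffSMul.continuousSMul (I := 𝓡 k) (I' := 𝓡 n) ∞
  exact contMDiff_of_forall_apply_smul heff f φ hφ
    (continuous_of_forall_apply_smul heff f.toHomeomorph φ hφ)

theorem isEquivariantDiffeo_of_normalizes
    (heff : ∀ a b : G, (∀ x : M, a • x = b • x) → a = b) {o : M}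
    {f : Diff n M} (hfo : f o = o) {φ : G ≃* G} (hφ : ∀ (a : G) x, f (a • x) = φ a • f x) :
    IsEquivariantDiffeo (k := k) G o f := by
  refine ⟨φ, contMDiff_of_normalizes heff f φ hφ,
    contMDiff_of_normalizes heff f.symm φ.symm (symm_normalizes hφ), ?_, fun a => by
      rw [hφ, hfo]⟩
  ext b
  rw [Subgroup.mem_map]
  simp only [MulAction.mem_stabilizer_iff]
  constructor
  · rintro ⟨a, ha, rfl⟩
    change φ a • o = o
    have h := hφ a o
    rwa [ha, hfo, eq_comm] at h
  · intro hb
    refine ⟨φ.symm b, ?_, φ.apply_symm_apply b⟩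
    apply f.injective
    change f (φ.symm b • o) = f o
    rw [hφ, hfo, φ.apply_symm_apply, hb]

/-- The bracket of the Lie algebra of `G`, on the model space. -/
def lieBilin (k : ℕ) (G : Type*) [Group G] [TopologicalSpace G]
    [ChartedSpace (EuclideanSpace ℝ (Fin k)) G] [LieGroup (𝓡 k) ∞ G] :
    EuclideanSpace ℝ (Fin k) →ₗ[ℝ] EuclideanSpace ℝ (Fin k) →ₗ[ℝ] EuclideanSpace ℝ (Fin k) :=
  let B : GroupLieAlgebra (𝓡 k) G →ₗ[ℝ] GroupLieAlgebra (𝓡 k) G →ₗ[ℝ] GroupLieAlgebra (𝓡 k) G :=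
    LinearMap.mk₂ ℝ (fun v w => ⁅v, w⁆) add_lie smul_lie lie_add lie_smul
  B

/-- A Leibniz operator on the model space as a derivation of the Lie algebra. -/
def lieDerivationOfLeibniz (D : EuclideanSpace ℝ (Fin k) →L[ℝ] EuclideanSpace ℝ (Fin k))
    (hD : ∀ v w, D (lieBilin k G v w) = lieBilin k G (D v) w + lieBilin k G v (D w)) :
    LieDerivation ℝ (GroupLieAlgebra (𝓡 k) G) (GroupLieAlgebra (𝓡 k) G) where
  toLinearMap := (D : EuclideanSpace ℝ (Fin k) →ₗ[ℝ] EuclideanSpace ℝ (Fin k))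
  leibniz' v w := by
    let D' : GroupLieAlgebra (𝓡 k) G →ₗ[ℝ] GroupLieAlgebra (𝓡 k) G := D.toLinearMap
    have h : D' ⁅v, w⁆ = ⁅D' v, w⁆ + ⁅v, D' w⁆ := hD v w
    change D' ⁅v, w⁆ = ⁅v, D' w⁆ - ⁅w, D' v⁆
    rw [h, ← lie_skew w, sub_neg_eq_add, add_comm]

end Normalizing

end HomSoliton

end

/-! ### The theorem on self-similar homogeneous solutions -/

open HomSoliton in
theorem theorem5p2 {n k m : ℕ} {r s : Fin m → ℕ}
    {M : Type*} [TopologicalSpace M] [ChartedSpace (EuclideanSpace ℝ (Fin n)) M]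
    [IsManifold (𝓡 n) ∞ M] [T2Space M] [SecondCountableTopology M]
    -- the space of structures and the preferred direction
    (Γ : Set (TensorField r s n M)) (q : TensorField r s n M → TensorField r s n M)
    (hq : IsPreferredDirection Γ q)
    -- a homogeneous soliton
    (γ : TensorField r s n M) (hγ : γ ∈ Γ) (hsol : IsSoliton q γ) (hhom : IsHomogeneous γ)
    -- `Aut(M, γ)` is a Lie group `G`
    (G : Type*) [Group G] [TopologicalSpace G] [ChartedSpace (EuclideanSpace ℝ (Fin k)) G]
    [LieGroup (𝓡 k) ∞ G] [T2Space G] [SecondCountableTopology G]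
    [MulAction G M] [ContMDiffSMul (𝓡 k) (𝓡 n) ∞ G M] (hG : IsAutomorphismGroup G γ)
    -- the origin; the flow on `G`-invariant structures is given by a smooth vector field
    (o : M) (hreg : IsSmoothOnInvariants G o Γ q)
    -- the `Aut(M, γ)`-invariant solution starting at `γ`
    (J : Set ℝ) (hJ : IsOpen J) (hJc : J.OrdConnected) (h0 : (0 : ℝ) ∈ J)
    (γt : ℝ → TensorField r s n M) (hγ0 : γt 0 = γ) (hflow : IsFlowSolution Γ q J γt)
    (hinv : ∀ t ∈ J, IsInvariant G (γt t))
    -- it is self-similar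
    (hself : ∃ (c : ℝ → ℝ) (f : ℝ → Diff n M),
      ∀ t ∈ J, c t ≠ 0 ∧ γt t = c t • pullback (f t) γ) :
    IsSemiAlgebraicSoliton (k := k) G o q γ ∧
    ∃ (c : ℝ → ℝ) (f : ℝ → Diff n M), c 0 = 1 ∧ (∀ x, f 0 x = x) ∧
      ∀ t ∈ J, c t ≠ 0 ∧ IsEquivariantDiffeo (k := k) G o (f t) ∧ γt t = c t • pullback (f t) γ := by
  classical
  obtain ⟨c, f₀, hcf⟩ := hself
  have hex : ∀ t, ∃ (f : Diff n M) (φ : G ≃* G), t ∈ J → f o = o ∧ γt t = c t • pullback f γ ∧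
      ∀ (a : G) x, f (a • x) = φ a • f x := by
    intro t
    by_cases ht : t ∈ J
    · obtain ⟨f, φ, h⟩ := exists_normalizing_diffeo k hq hhom hG hreg hJ hJc h0 hγ0 hflow hinv ht
        (hcf t ht).1 (hcf t ht).2
      exact ⟨f, φ, fun _ => h⟩
    · exact ⟨Diffeomorph.refl _ _ _, MulEquiv.refl _, fun h => absurd h ht⟩
  choose f φ hf using hex
  refine ⟨?_, ?_⟩
  · obtain ⟨-, Q, hQ, -, hQq⟩ := id hreg
    have hmem : ∀ t ∈ J, γt t o ∈ invariantValues G o Γ := fun t ht =>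
      ⟨_, (hflow t ht).1, hinv t ht, rfl⟩
    have hx : ∀ t ∈ J, HasDerivAt (fun u => γt u o) (q (γt t) o) t := fun t ht => (hflow t ht).2 o
    -- Continuity of the velocity comes from the vector field `Q` along the invariant values, not
    -- from the scalars and diffeomorphisms, which may vary irregularly with `t`.
    have hx' : ContinuousAt (fun t => q (γt t) o) 0 := by
      have h1 : ContinuousWithinAt Q (invariantValues G o Γ) (γt 0 o) :=
        hQ.continuousOn _ (hmem 0 h0)
      have h2 : Filter.Tendsto (fun u => γt u o) (𝓝 0)
          (𝓝[invariantValues G o Γ] (γt 0 o)) :=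
        tendsto_nhdsWithin_iff.2 ⟨(hx 0 h0).continuousAt, by
          filter_upwards [hJ.mem_nhds h0] with t ht using hmem t ht⟩
      have h3 : (fun t => Q (γt t o)) =ᶠ[𝓝 0] fun t => q (γt t) o := by
        filter_upwards [hJ.mem_nhds h0] with t ht
        exact (hQq _ (hflow t ht).1 (hinv t ht)).symm
      exact (show ContinuousAt (fun t => Q (γt t o)) 0 from h1.tendsto.comp h2).congr h3
    -- The orbit criterion is applied with the Lie bracket as the tensor and `dπ` as `T`. Each time
    -- `t` is realised by the scalar `c t` and the differentials of `φ t` at `1` and of `f t` at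
    -- `o`.
    obtain ⟨c', D, A, hD, hA, hqγ⟩ := exists_derivation_of_orbit (bilinTensor (lieBilin k G))
      (differential (n := k) (n' := n) (fun a : G => a • o) 1) hJ h0 hx hx' (fun t ht => by
        obtain ⟨hfo, hγt, hφ⟩ := hf t ht
        have hφs := contMDiff_of_normalizes (k := k) hG.effective (f t) (φ t) hφ
        have hφs' := contMDiff_of_normalizes (k := k) hG.effective (f t).symm (φ t).symm
          (symm_normalizes hφ)
        have hd : ∀ a, MDifferentiableAt (𝓡 k) (𝓡 k) (φ t) a := hφs.mdifferentiable (by simp)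
        have hd' : ∀ a, MDifferentiableAt (𝓡 k) (𝓡 k) (φ t).symm a :=
          hφs'.mdifferentiable (by simp)
        have h1 : (differential (n := k) (n' := k) (φ t) 1).comp
            (differential (n := k) (n' := k) (φ t).symm 1) = .id ℝ _ := by
          have h := differential_comp (n₁ := k) (n₂ := k) (n₃ := k) (1 : G) (hd _) (hd' 1)
          rw [MulEquiv.self_comp_symm, differential_id, map_one] at h
          exact h.symm
        have h2 : (differential (n := k) (n' := k) (φ t).symm 1).comp
            (differential (n := k) (n' := k) (φ t) 1) = .id ℝ _ := by
          have h := differential_comp (n₁ := k) (n₂ := k) (n₃ := k) (1 : G) (hd' _) (hd 1)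
          rw [MulEquiv.symm_comp_self, differential_id, map_one] at h
          exact h.symm
        refine ⟨c t, _, _, differential (n := n) (n' := n) (f t) o,
          differential (n := n) (n' := n) (f t).symm (f t o), (hcf t ht).1, h1, h2,
          differential_comp_symm _ _, differential_symm_comp _ _,
          pull_bilinTensor _ h2 (groupDifferential_lie hφs hφs'), differential_comp_dProj hfo hφs hφ,
          ?_⟩
        rw [hγt, hγ0]
        change c t • Tensors.pull _ _ (γ (f t o)) = _
        rw [hfo])
    have hA' : ∀ X, A (dProj (k := k) (n := n) G o X) = dProj (k := k) (n := n) G o (D X) :=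
      fun X => DFunLike.congr_fun hA X
    refine ⟨c', lieDerivationOfLeibniz D (leibniz_of_theta_bilinTensor _ hD), A, fun X hX => ?_,
      hA', ?_⟩
    · exact (hA' X).symm.trans (by rw [hX, map_zero])
    · rw [← hγ0]
      exact hqγ
  -- The given data at `t = 0` need not be trivial, so they are replaced there by `1` and the
  -- identity; this is allowed because `γ(0) = γ`.
  · refine ⟨fun t => if t = 0 then 1 else c t,
      fun t => if t = 0 then Diffeomorph.refl _ _ _ else f t, if_pos rfl,
      fun x => by simp only [if_true]; rfl, fun t ht => ?_⟩
    by_cases h : t = 0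
    · subst h
      simp only [if_true]
      refine ⟨one_ne_zero, isEquivariantDiffeo_of_normalizes (φ := MulEquiv.refl G) hG.effective rfl
        fun _ _ => rfl, ?_⟩
      rw [pullback_refl, one_smul, hγ0]
    · simp only [if_neg h]
      obtain ⟨hfo, hγt, hφ⟩ := hf t ht
      exact ⟨(hcf t ht).1, isEquivariantDiffeo_of_normalizes hG.effective hfo hφ, hγt⟩
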